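/- Let $k=\mathbb R$ or $\mathbb C$, let $n\ge 2$, and let $M$ be a connected triangulated $n$-manifold without boundary (not necessarily compact or orientable). Of the manifold $M$ only the following is used: the link of every simplex $\sigma$ of the triangulation has the integral homology of a sphere of dimension $n-\dim\sigma-1$. A discrete $GL_n$-connection on $M$ is a set of numbers $\mu^T_{ij}\in k^*$, for all $n$-simplices $T$ and vertices $i,j$ of $T$, with $\mu^T_{ii}=1$, $\mu^T_{ij}\mu^T_{ji}=1$, and $\mu^T_{ij}\mu^T_{jl}\mu^T_{li}=-1$ for distinct $i,j,l$. An abelian gauge transformation replaces $\mu^T_{ij}$ by $(h_i/h_j)\mu^T_{ij}$, where $h_i\in k^*$ is a function of the vertices. A framed path is a sequence of edges $[i_p,i_{p+1}]$, each equipped with an $n$-simplex $T_p$ containing it; its framed abelian holonomy is $\mu(\gamma)=\prod_p(-\mu^{T_p}_{i_pi_{p+1}})$. The framed homology group $H_1^{fr}(M)$ is the abelianization of the group of framed closed paths at a base vertex modulo the relations $\langle i,j|T\rangle\langle j,i|T\rangle=1$ and $\langle i,j|T\rangle\langle j,l|T\rangle\langle l,i|T\rangle=1$, and the holonomy defines a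 representation $\mu:H_1^{fr}(M)\to k^*$. For $i\ne j$ in $T\cap T'$ put $\rho^{TT'}_{ij}=\mu^T_{ij}\mu^{T'}_{ji}$, the holonomy of $\langle i,j,i|T,T'\rangle$. 1. (Uniqueness.) Two discrete connections have the same framed abelian holonomy representation if and only if they differ by an abelian gauge transformation. 2. (Data.) Let framed closed paths $\gamma_s$ (of infinite order) and $a_s$ (of finite order $m_s$) represent a basis of $H_1(M,\mathbb Z)$, so that the only relations between their classes are $m_s[a_s]=0$. Let $u_s$ be integral 2-chains with $\partial u_s=m_sa_s$, and let $z_s$ be integral 2-cycles generating $H_2(M,\mathbb Z)$; all are written as formal sums of oriented 2-simplices $\Delta$, each framed by an $n$-simplex containing it. Let numbers in $k^*$ be given: $\rho^{TT'}_{ij}$ for all pairs of $n$-simplices $T,T'$ with a common $(n-1)$-face and all $i\ne j$ in $T\cap T'$, and $\mu(\gamma_s)$, $\mu(a_s)$. For $T,T'$ containing the edge $[ij]$ but not sharing an $(n-1)$-face, $\rho^{TT'}_{ij}$ denotes the product $\prod_p\rho_{ij}^{T_pT_{p+1}}$ along a chosen sequence of $n$-simplices from $T$ to $T'$ that contain $[ij]$,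 with consecutive ones sharing an $(n-1)$-face; $\rho^{TT}_{ij}=1$. 3. (Necessary and sufficient conditions.) There is a discrete connection whose framed abelian holonomy has these values if and only if (local) $\rho^{TT'}_{ij}\rho^{TT'}_{ji}=1$ and $\rho^{TT'}_{ij}\rho^{T'T}_{ij}=1$; (A) $\rho^{TT'}_{ij}\rho^{TT'}_{jl}\rho^{TT'}_{li}=1$ for every triangle $[ijl]\subset T\cap T'$; (B) $\prod_p\rho^{T_pT_{p+1}}_{ij}=1$ for the cyclic sequence of $n$-simplices around every $(n-2)$-simplex containing $[ij]$, that is, along the boundary of its dual 2-cell; (homological) $\prod\rho^{T_\Delta T_{\Delta'}}_{ij}=1$ for every $z_s$ and $\prod\rho^{T_\Delta T_{\Delta'}}_{ij}=\mu(a_s)^{m_s}$ for every $u_s$. The product is over the pairs, in a chosen pairing, in which the boundary edges of the framed 2-simplices (for $u_s$, together with $m_s$ copies of the framed edges of the inverse path $a_s^{-1}$) cancel: $[ji]$ framed by $T_\Delta$ and $[ij]$ framed by $T_{\Delta'}$. This connection is then unique up to abelian gauge transformation. Moreover, for every discrete connection the local relations and (A) hold, (B) holds along every closed sequence of $n$-simplices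 containing $[ij]$ with consecutive ones sharing an $(n-1)$-face, and the homological relations hold for every framed integral 2-cycle and for every framed 2-chain $u$ with $\partial u=ra$, $a$ a framed closed path and $r\ge0$. -/

import Mathlib

/-!
Discrete connections on triangulated manifolds.  A simplicial complex `K` is an
`AbstractSimplicialComplex V`; every element of `V` is one of its vertices.
-/

namespace DiscreteConnection

universe u v

variable {V : Type u}

/-! ### Simplicial homology and triangulated manifolds -/

section Homology

variable [DecidableEq V]

/-- The ordered simplices of `L` with `q` vertices: injective `q`-tuples of vertices that span a
simplex.  For `q = 0` this is the empty simplex, so that the homology below is reduced. -/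
def orderedSimplices (L : PreAbstractSimplicialComplex V) (q : ℕ) : Set (Fin q → V) :=
  {w | Function.Injective w ∧ (q = 0 ∨ Finset.univ.image w ∈ L)}

/-- Integral combinations of ordered simplices with `q` vertices. -/
noncomputable def chains (L : PreAbstractSimplicialComplex V) (q : ℕ) :
    AddSubgroup ((Fin q → V) →₀ ℤ) :=
  AddSubgroup.closure {x | ∃ w ∈ orderedSimplices L q, x = Finsupp.single w 1}

/-- The orientation relations: renumbering the vertices of a simplex by a permutation multiplies
it by the sign of the permutation.  Oriented chains are `chains` modulo these relations. -/
noncomputable def orientationRelations (L : PreAbstractSimplicialComplex V) (q : ℕ) :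
    AddSubgroup ((Fin q → V) →₀ ℤ) :=
  AddSubgroup.closure {x | ∃ w ∈ orderedSimplices L q, ∃ π : Equiv.Perm (Fin q),
    x = Finsupp.single (w ∘ π) 1 - Finsupp.single w ((Equiv.Perm.sign π : ℤˣ) : ℤ)}

/-- `∂[w₀, …, w_q] = ∑ r, (-1)^r [w₀, …, ŵ_r, …, w_q]`. -/
noncomputable def boundary (V : Type u) (q : ℕ) :
    ((Fin (q + 1) → V) →₀ ℤ) →+ ((Fin q → V) →₀ ℤ) :=
  Finsupp.liftAddHom fun w => ∑ r : Fin (q + 1),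
    (Finsupp.singleAddHom (w ∘ r.succAbove)).comp
      (AddMonoidHom.mulLeft ((-1 : ℤ) ^ (r : ℕ)))

/-- The cycles among the chains of simplices with `q` vertices (dimension `q - 1`), modulo
orientation relations. -/
noncomputable def cycles (L : PreAbstractSimplicialComplex V) :
    (q : ℕ) → AddSubgroup ((Fin q → V) →₀ ℤ)
  | 0 => chains L 0
  | q + 1 => chains L (q + 1) ⊓ (orientationRelations L q).comap (boundary V q)

/-- The boundaries among the chains of simplices with `q` vertices (dimension `q - 1`), together
with the orientation relations. -/
noncomputable def boundaries (L : PreAbstractSimplicialComplex V) (q : ℕ) :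
    AddSubgroup ((Fin q → V) →₀ ℤ) :=
  (chains L (q + 1)).map (boundary V q) ⊔ orientationRelations L q

/-- The reduced integral simplicial homology of `L` in dimension `q - 1`. -/
abbrev ReducedHomology (L : PreAbstractSimplicialComplex V) (q : ℕ) : Type u :=
  cycles L q ⧸ (boundaries L q).addSubgroupOf (cycles L q)

/-- The link of `σ`: the nonempty `τ` disjoint from `σ` for which `σ ∪ τ` is a simplex. -/
def link (K : AbstractSimplicialComplex V) (σ : Finset V) : PreAbstractSimplicialComplex V where
  faces := {τ | τ.Nonempty ∧ Disjoint σ τ ∧ σ ∪ τ ∈ K}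
  isRelLowerSet_faces := fun {_} h => ⟨h.1, fun _ hle hne =>
    ⟨hne, Finset.disjoint_of_subset_right hle h.2.1,
      (K.isRelLowerSet_faces h.2.2).2 (Finset.union_subset_union_right hle)
        (hne.mono Finset.subset_union_right)⟩⟩

/-- `K` is a triangulated `n`-manifold, possibly noncompact or nonorientable, in the widest sense
(a homology manifold without boundary): the link of every simplex `σ` has the integral homology
of the sphere of dimension `n - dim σ - 1 = n - #σ`, i.e. reduced homology `ℤ` in that dimension
and `0` in all others.  Every triangulation of a topological `n`-manifold without boundary, and
in particular every combinatorial `n`-manifold, is of this kind.  The condition forces every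
simplex to lie in an `n`-simplex and no simplex to have dimension above `n`. -/
def IsTriangulatedManifold (K : AbstractSimplicialComplex V) (n : ℕ) : Prop :=
  ∀ σ ∈ K, ∀ q : ℕ,
    (q + σ.card = n + 1 → Nonempty (ReducedHomology (link K σ) q ≃+ ℤ)) ∧
    (q + σ.card ≠ n + 1 → Subsingleton (ReducedHomology (link K σ) q))

/-- The 1-skeleton of `K`. -/
def edgeGraph (K : AbstractSimplicialComplex V) : SimpleGraph V where
  Adj i j := i ≠ j ∧ ({i, j} : Finset V) ∈ K
  symm := ⟨fun i j h => ⟨h.1.symm, by rw [Finset.pair_comm]; exact h.2⟩⟩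
  loopless := ⟨fun _ h => h.1 rfl⟩

end Homology

/-! ### Connections -/

variable {K : AbstractSimplicialComplex V} {n : ℕ}

/-- The `n`-simplices of `K`. -/
abbrev Facet (K : AbstractSimplicialComplex V) (n : ℕ) : Type u :=
  {T : Finset V // T ∈ K ∧ T.card = n + 1}

/-- A discrete connection: nonzero numbers `μ T i j` (`i`, `j` vertices of the `n`-simplex `T`)
satisfying the relations of `μ T i j = - b T i / b T j` for `i ≠ j`.  The values of `coeff` at
vertices outside `T` have no meaning and enter no statement. -/
structure Connection (K : AbstractSimplicialComplex V) (n : ℕ) (k : Type v) [Field k] where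
  coeff : Facet K n → V → V → kˣ
  diag : ∀ (T : Facet K n) (i : V), i ∈ T.1 → coeff T i i = 1
  inv : ∀ (T : Facet K n) (i j : V), i ∈ T.1 → j ∈ T.1 → coeff T i j * coeff T j i = 1
  triangle : ∀ (T : Facet K n) (i j l : V), i ∈ T.1 → j ∈ T.1 → l ∈ T.1 →
    i ≠ j → j ≠ l → l ≠ i → coeff T i j * coeff T j l * coeff T l i = -1

/-- Abelian gauge equivalence: `μ' T i j = (h i / h j) * μ T i j`. -/
def GaugeEquivalent {k : Type v} [Field k] (μ μ' : Connection K n k) : Prop :=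
  ∃ h : V → kˣ, ∀ (T : Facet K n) (i j : V), i ∈ T.1 → j ∈ T.1 →
    μ'.coeff T i j = h i / h j * μ.coeff T i j

/-- The gauge-invariant coefficients `ρ T T' i j = μ T i j * μ T' j i`; they have a meaning when
`i` and `j` are common vertices of `T` and `T'`. -/
def Connection.rho {k : Type v} [Field k] (μ : Connection K n k) (T T' : Facet K n) (i j : V) :
    kˣ :=
  μ.coeff T i j * μ.coeff T' j i

/-! ### Framed paths, the framed fundamental group and framed homology -/

/-- `i` and `j` span an edge of `T`. -/
def IsEdge (T : Facet K n) (i j : V) : Prop := i ≠ j ∧ i ∈ T.1 ∧ j ∈ T.1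


theorem IsEdge.symm {T : Facet K n} {i j : V} (h : IsEdge T i j) : IsEdge T j i :=
  ⟨h.1.symm, h.2.2, h.2.1⟩

/-- An oriented edge from `fst` to `snd` framed by an `n`-simplex. -/
abbrev FramedEdge (K : AbstractSimplicialComplex V) (n : ℕ) : Type u := V × V × Facet K n

/-- Framed combinatorial paths: sequences of edges, each equipped with an `n`-simplex
containing it. -/
inductive FramedPath (K : AbstractSimplicialComplex V) (n : ℕ) : V → V → Type u
  | nil (i : V) : FramedPath K n i i
  | cons {i j l : V} (T : Facet K n) (h : IsEdge T i j) (p : FramedPath K n j l) :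
      FramedPath K n i l

namespace FramedPath

/-- The framed oriented edges of a framed path. -/
def edges {i j : V} : FramedPath K n i j → List (FramedEdge K n)
  | nil _ => []
  | @cons _ _ _ i j _ T _ p => (i, j, T) :: p.edges

/-- Concatenation. -/
def comp {i j l : V} : FramedPath K n i j → FramedPath K n j l → FramedPath K n i l
  | nil _, q => q
  | cons T h p, q => cons T h (p.comp q)

/-- The inverse framed path. -/
def reverse {i j : V} : FramedPath K n i j → FramedPath K n j i
  | nil i => nil i
  | cons T h p => p.reverse.comp (cons T h.symm (nil _))

/-- A single framed edge. -/
def single {i j : V} (T : Facet K n) (h : IsEdge T i j) : FramedPath K n i j := cons T h (nil j)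

theorem comp_nil {i j : V} (p : FramedPath K n i j) : p.comp (nil j) = p := by
  induction p with
  | nil => rfl
  | cons T h p ih => simp only [comp, ih]

theorem comp_assoc {i j l m : V} (p : FramedPath K n i j) (q : FramedPath K n j l)
    (r : FramedPath K n l m) : (p.comp q).comp r = p.comp (q.comp r) := by
  induction p with
  | nil => rfl
  | cons T h p ih => simp only [comp, ih]

theorem reverse_comp {i j l : V} (p : FramedPath K n i j) (q : FramedPath K n j l) :
    (p.comp q).reverse = q.reverse.comp p.reverse := by
  induction p with
  | nil => simp only [comp, reverse, comp_nil]
  | cons T h p ih => simp only [comp, reverse, ih, comp_assoc]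

theorem edges_comp {i j l : V} (p : FramedPath K n i j) (q : FramedPath K n j l) :
    (p.comp q).edges = p.edges ++ q.edges := by
  induction p with
  | nil => rfl
  | cons T h p ih => simp only [comp, edges, ih, List.cons_append]

end FramedPath

/-- The semigroup of framed closed paths starting and ending in `x₀`. -/
abbrev FramedLoop (K : AbstractSimplicialComplex V) (n : ℕ) (x₀ : V) : Type u :=
  FramedPath K n x₀ x₀

instance (x₀ : V) : Monoid (FramedLoop K n x₀) where
  mul p q := p.comp q
  one := FramedPath.nil x₀
  mul_assoc p q r := p.comp_assoc q r
  one_mul _ := rfl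
  mul_one p := p.comp_nil

theorem FramedLoop.mul_def {x₀ : V} (p q : FramedLoop K n x₀) : p * q = p.comp q := rfl

theorem FramedLoop.one_def {x₀ : V} : (1 : FramedLoop K n x₀) = FramedPath.nil x₀ := rfl

/-- The relations `<i,j|T><j,i|T> = 1` and `<i,j|T><j,l|T><l,i|T> = 1` for vertices of one
`n`-simplex `T`: such pieces may be removed wherever they occur in a path. -/
inductive FramedRelation (K : AbstractSimplicialComplex V) (n : ℕ) (x₀ : V) :
    FramedLoop K n x₀ → FramedLoop K n x₀ → Prop
  | backtrack {i j : V} (T : Facet K n) (h : IsEdge T i j)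
      (p : FramedPath K n x₀ i) (q : FramedPath K n i x₀) :
      FramedRelation K n x₀ (p.comp (.cons T h (.cons T h.symm q))) (p.comp q)
  | triangle {i j l : V} (T : Facet K n) (hij : IsEdge T i j) (hjl : IsEdge T j l)
      (hli : IsEdge T l i) (p : FramedPath K n x₀ i) (q : FramedPath K n i x₀) :
      FramedRelation K n x₀ (p.comp (.cons T hij (.cons T hjl (.cons T hli q)))) (p.comp q)

/-- The congruence on framed closed paths generated by these relations. -/
def framedCon (K : AbstractSimplicialComplex V) (n : ℕ) (x₀ : V) : Con (FramedLoop K n x₀) :=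
  conGen (FramedRelation K n x₀)

theorem framedCon_of {x₀ : V} {p q : FramedLoop K n x₀} (h : FramedRelation K n x₀ p q) :
    framedCon K n x₀ p q :=
  ConGen.Rel.of _ _ h

/-- The framed fundamental group. -/
def FramedFundamentalGroup (K : AbstractSimplicialComplex V) (n : ℕ) (x₀ : V) : Type u :=
  (framedCon K n x₀).Quotient

instance (x₀ : V) : Monoid (FramedFundamentalGroup K n x₀) :=
  inferInstanceAs (Monoid (framedCon K n x₀).Quotient)

/-- Reversal of paths, as a homomorphism to the opposite monoid. -/
def reverseHom (K : AbstractSimplicialComplex V) (n : ℕ) (x₀ : V) :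
    FramedLoop K n x₀ →* ((framedCon K n x₀).Quotient)ᵐᵒᵖ where
  toFun p := MulOpposite.op ((FramedPath.reverse p : FramedLoop K n x₀) :
    (framedCon K n x₀).Quotient)
  map_one' := rfl
  map_mul' p q := by
    rw [FramedLoop.mul_def, FramedPath.reverse_comp, ← MulOpposite.op_mul, ← Con.coe_mul]
    rfl

theorem framedCon_le_ker (x₀ : V) : framedCon K n x₀ ≤ Con.ker (reverseHom K n x₀) := by
  refine Con.conGen_le.2 fun a b h => ?_
  refine (congrArg MulOpposite.op ((Con.eq _).2 (framedCon_of ?_)) :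
    reverseHom K n x₀ a = reverseHom K n x₀ b)
  cases h with
  | backtrack T h p q =>
    simp only [FramedPath.reverse_comp, FramedPath.reverse, FramedPath.comp_assoc,
      FramedPath.comp]
    exact .backtrack T h _ _
  | triangle T hij hjl hli p q =>
    simp only [FramedPath.reverse_comp, FramedPath.reverse, FramedPath.comp_assoc,
      FramedPath.comp]
    exact .triangle T hli.symm hjl.symm hij.symm _ _

theorem framedCon_reverse {x₀ i : V} (p : FramedPath K n x₀ i) :
    ∀ {l : V} (r : FramedPath K n i l) (q : FramedPath K n i x₀),
      framedCon K n x₀ (p.comp ((r.comp r.reverse).comp q)) (p.comp q) := by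
  intro l r
  induction r with
  | nil => exact fun q => (framedCon K n x₀).refl _
  | @cons i j l T h r ih =>
    intro q
    have h1 := ih (p.comp (.single T h)) (FramedPath.cons T h.symm q)
    simp only [FramedPath.comp_assoc, FramedPath.single, FramedPath.comp] at h1
    have h2 := framedCon_of (FramedRelation.backtrack T h p q)
    simp only [FramedPath.reverse, FramedPath.comp_assoc, FramedPath.comp]
    exact (framedCon K n x₀).trans h1 h2

/-- Inverse paths give inverses in the framed fundamental group. -/
instance (x₀ : V) : Group (FramedFundamentalGroup K n x₀) :=
  { (inferInstance : Monoid (FramedFundamentalGroup K n x₀)) with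
    inv := fun a => MulOpposite.unop
      (Con.lift (framedCon K n x₀) (reverseHom K n x₀) (framedCon_le_ker x₀) a)
    inv_mul_cancel := by
      have key : ∀ a : (framedCon K n x₀).Quotient, a * MulOpposite.unop
          (Con.lift (framedCon K n x₀) (reverseHom K n x₀) (framedCon_le_ker x₀) a) = 1 := by
        intro a
        induction a using Con.induction_on with
        | H p =>
          refine (Con.eq _).2 ?_
          have h := framedCon_reverse (FramedPath.nil x₀) p (FramedPath.nil x₀)
          simp only [FramedPath.comp, FramedPath.comp_nil] at h
          exact h
      intro a
      have h1 := key a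
      have h2 := key (MulOpposite.unop
        (Con.lift (framedCon K n x₀) (reverseHom K n x₀) (framedCon_le_ker x₀) a))
      rwa [← left_inv_eq_right_inv h1 h2] at h2 }

/-- The framed homology group `H₁^fr`: the abelianized framed fundamental group. -/
abbrev FramedHomology (K : AbstractSimplicialComplex V) (n : ℕ) (x₀ : V) : Type u :=
  Abelianization (FramedFundamentalGroup K n x₀)

section Holonomy

variable {k : Type v} [Field k]

/-- The framed abelian holonomy `∏ (- μ T i j)` along a list of framed oriented edges. -/
def Connection.edgeProd (μ : Connection K n k) (E : List (FramedEdge K n)) : kˣ :=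
  (E.map fun e => - μ.coeff e.2.2 e.1 e.2.1).prod

/-- The framed abelian holonomy of a framed path. -/
def Connection.holonomy (μ : Connection K n k) {i j : V} (p : FramedPath K n i j) : kˣ :=
  μ.edgeProd p.edges

theorem Connection.holonomy_comp (μ : Connection K n k) {i j l : V} (p : FramedPath K n i j)
    (q : FramedPath K n j l) : μ.holonomy (p.comp q) = μ.holonomy p * μ.holonomy q := by
  simp only [holonomy, edgeProd, FramedPath.edges_comp, List.map_append, List.prod_append]

/-- The holonomy of framed closed paths. -/
def Connection.holonomyLoop (μ : Connection K n k) (x₀ : V) : FramedLoop K n x₀ →* kˣ where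
  toFun p := μ.holonomy p
  map_one' := rfl
  map_mul' p q := μ.holonomy_comp p q

theorem Connection.framedCon_le_ker_holonomy (μ : Connection K n k) (x₀ : V) :
    framedCon K n x₀ ≤ Con.ker (μ.holonomyLoop x₀) := by
  refine Con.conGen_le.2 fun a b h => ?_
  refine (?_ : μ.holonomy a = μ.holonomy b)
  cases h with
  | backtrack T h p q =>
    have h1 := μ.inv T _ _ h.2.1 h.2.2
    simp only [holonomy_comp]
    congr 1
    simp only [holonomy, edgeProd, FramedPath.edges, List.map_cons, List.prod_cons]
    rw [← mul_assoc, neg_mul_neg, h1, one_mul]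
  | triangle T hij hjl hli p q =>
    have h1 := μ.triangle T _ _ _ hij.2.1 hjl.2.1 hli.2.1 hij.1 hjl.1 hli.1
    simp only [holonomy_comp]
    congr 1
    simp only [holonomy, edgeProd, FramedPath.edges, List.map_cons, List.prod_cons]
    rw [← mul_assoc, ← mul_assoc, neg_mul_neg, mul_neg, h1, neg_neg, one_mul]

/-- The framed abelian holonomy representation `H₁^fr → kˣ` of a connection. -/
def Connection.holonomyRep (μ : Connection K n k) (x₀ : V) : FramedHomology K n x₀ →* kˣ :=
  Abelianization.lift (Con.lift (framedCon K n x₀) (μ.holonomyLoop x₀)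
    (μ.framedCon_le_ker_holonomy x₀) : FramedFundamentalGroup K n x₀ →* kˣ)

end Holonomy

/-! ### The data and the relations between them -/

section Relations

variable [DecidableEq V]

/-- The 1-skeleton of the dual cell decomposition: its vertices are the `n`-simplices, and
two of them are joined when they share a face of dimension `n - 1`. -/
def dualGraph (K : AbstractSimplicialComplex V) (n : ℕ) : SimpleGraph (Facet K n) where
  Adj T T' := T ≠ T' ∧ (T.1 ∩ T'.1).card = n
  symm := ⟨fun T T' h => ⟨h.1.symm, by rw [Finset.inter_comm]; exact h.2⟩⟩
  loopless := ⟨fun _ h => h.1 rfl⟩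

variable {k : Type v} [Field k]

/-- Prescribed values for the minimal set of gauge-invariant coefficients `ρ T T' i j`, where `T`
and `T'` are neighbours and `i ≠ j` are common vertices of `T` and `T'`.  Values at other
arguments have no meaning and enter no statement. -/
abbrev RhoData (K : AbstractSimplicialComplex V) (n : ℕ) (k : Type v) [Field k] :=
  Facet K n → Facet K n → V → V → kˣ

/-- `∏ ρ T_p T_{p+1} i j` along a dual path `T_0, T_1, …, T_N`; if all `T_p` contain `i` and `j`,
it is the coefficient `ρ T_0 T_N i j` recovered from the minimal set. -/
def RhoData.along (ρ : RhoData K n k) (i j : V) {T T' : Facet K n}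
    (w : (dualGraph K n).Walk T T') : kˣ :=
  (w.darts.map fun d => ρ d.fst d.snd i j).prod

/-- All simplices of the dual path `w` contain the vertices in `σ`. -/
def InStar (σ : Finset V) {T T' : Facet K n} (w : (dualGraph K n).Walk T T') : Prop :=
  ∀ X ∈ w.support, σ ⊆ X.1

/-- The local relations. -/
structure LocalRelations (ρ : RhoData K n k) : Prop where
  /-- `ρ` is multiplicatively antisymmetric in `i`, `j`. -/
  edge_inv : ∀ T T', (dualGraph K n).Adj T T' → ∀ i j, i ≠ j → {i, j} ⊆ T.1 ∩ T'.1 →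
    ρ T T' i j * ρ T T' j i = 1
  /-- `ρ` is multiplicatively antisymmetric in `T`, `T'`. -/
  facet_inv : ∀ T T', (dualGraph K n).Adj T T' → ∀ i j, i ≠ j → {i, j} ⊆ T.1 ∩ T'.1 →
    ρ T T' i j * ρ T' T i j = 1
  /-- Relation A, for every triangle in `T ∩ T'`. -/
  relation_A : ∀ T T', (dualGraph K n).Adj T T' → ∀ i j l, i ≠ j → j ≠ l → l ≠ i →
    {i, j, l} ⊆ T.1 ∩ T'.1 → ρ T T' i j * ρ T T' j l * ρ T T' l i = 1
  /-- Relation B, for the boundaries of the dual 2-cells: the cyclic sequence of all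
  `n`-simplices around an `(n-2)`-simplex `σ` containing `i` and `j`. -/
  relation_B : ∀ σ ∈ K, σ.card = n - 1 → ∀ i j, i ≠ j → {i, j} ⊆ σ →
    ∀ (T : Facet K n) (w : (dualGraph K n).Walk T T), w.IsCycle → InStar σ w →
      ρ.along i j w = 1

/-- Relation B for all closed paths in the dual 1-skeleton all of whose simplices contain the
edge `[i, j]`. -/
def ClosedPathRelation (ρ : RhoData K n k) : Prop :=
  ∀ i j, i ≠ j → ∀ (T : Facet K n) (w : (dualGraph K n).Walk T T), InStar {i, j} w →
    ρ.along i j w = 1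

/-- An oriented 2-simplex `[a, b, c]` framed by an `n`-simplex. -/
structure FramedTriangle (K : AbstractSimplicialComplex V) (n : ℕ) where
  (a b c : V)
  frame : Facet K n
  ab : IsEdge frame a b
  bc : IsEdge frame b c
  ca : IsEdge frame c a

/-- The boundary edges of a framed triangle, with the induced framing. -/
def FramedTriangle.edges (Δ : FramedTriangle K n) : List (FramedEdge K n) :=
  [(Δ.a, Δ.b, Δ.frame), (Δ.b, Δ.c, Δ.frame), (Δ.c, Δ.a, Δ.frame)]

/-- An edge occurring with opposite orientations and framings `frame`, `frame'` in two pieces of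
a chain, with a dual path in its star joining the framings. -/
structure FramedPair (K : AbstractSimplicialComplex V) (n : ℕ) where
  (i j : V)
  (frame frame' : Facet K n)
  ne : i ≠ j
  path : (dualGraph K n).Walk frame frame'
  inStar : InStar {i, j} path

/-- The two framed oriented edges that form the pair. -/
def FramedPair.edges (P : FramedPair K n) : List (FramedEdge K n) :=
  [(P.j, P.i, P.frame), (P.i, P.j, P.frame')]

/-- The product of `ρ frame frame' i j` over a list of pairs. -/
def pairProd (ρ : RhoData K n k) (pairs : List (FramedPair K n)) : kˣ :=
  (pairs.map fun P => ρ.along P.i P.j P.path).prod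

/-- The integral 2-chain underlying a list of framed triangles. -/
noncomputable def triangleChain (Δs : List (FramedTriangle K n)) : (Fin 3 → V) →₀ ℤ :=
  (Δs.map fun Δ => Finsupp.single ![Δ.a, Δ.b, Δ.c] 1).sum

/-- A framed integral 2-cycle: a formal sum of framed oriented triangles whose boundary edges
cancel in pairs, with a choice of the pairing. -/
structure FramedCycle (K : AbstractSimplicialComplex V) (n : ℕ) where
  triangles : List (FramedTriangle K n)
  pairs : List (FramedPair K n)
  closed : (triangles.flatMap FramedTriangle.edges : Multiset (FramedEdge K n)) =
    (pairs.flatMap FramedPair.edges : Multiset (FramedEdge K n))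

/-- A framed integral 2-chain `u` with `∂u = r a` for a framed closed path `a`: the boundary edges
of `u`, taken together with `r` copies of the inverse of `a`, cancel in pairs. -/
structure FramedTorsionChain {x : V} (a : FramedLoop K n x) (r : ℕ) where
  triangles : List (FramedTriangle K n)
  pairs : List (FramedPair K n)
  bounds : (triangles.flatMap FramedTriangle.edges : Multiset (FramedEdge K n)) +
      r • (FramedPath.edges (FramedPath.reverse a) : Multiset (FramedEdge K n)) =
    (pairs.flatMap FramedPair.edges : Multiset (FramedEdge K n))

/-- The integral 1-chain underlying a framed path. -/
noncomputable def pathChain {i j : V} (p : FramedPath K n i j) : (Fin 2 → V) →₀ ℤ :=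
  (p.edges.map fun e => Finsupp.single ![e.1, e.2.1] 1).sum

/-- A choice of framed closed paths `γ` (infinite order) and `a` (of orders `m`) representing a
basis of `H₁(M, ℤ)`, of framed 2-chains `u` with `∂u = m a`, and of framed 2-cycles `z`
generating `H₂(M, ℤ)`. -/
structure HomologyBasis (K : AbstractSimplicialComplex V) (n : ℕ) (G A Z : Type*) where
  γbase : G → V
  γ : ∀ s, FramedLoop K n (γbase s)
  abase : A → V
  a : ∀ s, FramedLoop K n (abase s)
  m : A → ℕ
  m_pos : ∀ s, 0 < m s
  u : ∀ s, FramedTorsionChain (a s) (m s)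
  z : Z → FramedCycle K n
  /-- The classes of the `γ` and `a` generate `H₁`. -/
  span_one : ∀ x ∈ cycles K.toPreAbstractSimplicialComplex 2, ∃ (f : G →₀ ℤ) (g : A →₀ ℤ),
    x - ((f.sum fun s c => c • pathChain (γ s)) + g.sum fun s c => c • pathChain (a s)) ∈
      boundaries K.toPreAbstractSimplicialComplex 2
  /-- The only relations between the classes of the `γ` and `a` are `m s • [a s] = 0`. -/
  indep : ∀ (f : G →₀ ℤ) (g : A →₀ ℤ),
    ((f.sum fun s c => c • pathChain (γ s)) + g.sum fun s c => c • pathChain (a s)) ∈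
      boundaries K.toPreAbstractSimplicialComplex 2 → f = 0 ∧ ∀ s, (m s : ℤ) ∣ g s
  /-- The classes of the `z` generate `H₂`. -/
  span_two : cycles K.toPreAbstractSimplicialComplex 3 ≤
    AddSubgroup.closure (Set.range fun s => triangleChain (z s).triangles) ⊔
      boundaries K.toPreAbstractSimplicialComplex 3

variable {G A Z : Type*}

/-- The homological relations: the product of the `ρ` over each `z s` is `1`, and over each `u s`
it is the `m s`-th power of the prescribed holonomy `α s` of `a s`. -/
structure HomologicalRelations (H : HomologyBasis K n G A Z) (ρ : RhoData K n k) (α : A → kˣ) :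
    Prop where
  cycle : ∀ s, pairProd ρ (H.z s).pairs = 1
  torsion : ∀ s, pairProd ρ (H.u s).pairs = α s ^ H.m s

/-- The framed abelian holonomy of `μ` takes the prescribed values: `ρ T T' i j` on the paths
`<i, j, i|T, T'>`, `c s` on `γ s` and `α s` on `a s`. -/
structure Realizes (H : HomologyBasis K n G A Z) (μ : Connection K n k) (ρ : RhoData K n k)
    (c : G → kˣ) (α : A → kˣ) : Prop where
  rho_eq : ∀ T T', (dualGraph K n).Adj T T' → ∀ i j, i ≠ j → {i, j} ⊆ T.1 ∩ T'.1 →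
    μ.rho T T' i j = ρ T T' i j
  γ_eq : ∀ s, μ.holonomy (H.γ s) = c s
  a_eq : ∀ s, μ.holonomy (H.a s) = α s

end Relations

end DiscreteConnection

/-!
All values are written additively: `-μ T i j` becomes a framed 1-cochain `g T i j`, antisymmetric
in `i`, `j` and with sum zero around every framed triangle, and holonomies become sums of `g`
along framed paths.  The numbers `ρ T T' i j` are the variation `g T i j - g T' i j` of `g` under
a change of the framing.

*Necessity.*  Sums of `ρ` along dual paths telescope to differences of `g`.  Hence the sum over
the pairs of a framed 2-chain is minus the sum of `g` over the paired edges
(`IsVariation.pairSum_cycle`, `IsVariation.pairSum_torsion`), and the triangles contribute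
nothing.

*Local reconstruction.*  Fix an edge `[i, j]`.  Relation B makes `ρ · · i j` a difference of a
potential on the star of every `(n-2)`-simplex containing the edge, since a closed dual path
decomposes into cycles and backtracks (`walkSum_eq_zero`).  Potentials descend to the stars of
smaller simplices `σ` (`IsTriangulatedManifold.hasPotential_of_codim_two`): the potentials on the
stars of `σ ∪ {v}` differ by constants, because stars are strongly connected
(`IsTriangulatedManifold.star_eq`); these constants form a 1-cocycle on the link of `σ`, and this
is a coboundary, because the link has no first homology.  For `n = 2` the edge lies in just two
triangles and there is nothing to glue.  Thus `ρ` is the variation of some antisymmetric `g`, and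
by relation A its sums around triangles do not depend on the framing.

*Global reconstruction.*  It remains to add to `g` an unframed 1-cochain `e` that makes all
triangle sums zero and gives the holonomies of the `γ s` and `a s` their values
(`exists_correction`).  These requirements prescribe `e` on generators of the group of 1-cycles.
The relations among these generators come from 2-cycles and from the chains `u s`, and the
homological relations say precisely that the prescription respects them.  A homomorphism on the
1-cycles extends to all 1-chains, because paths from a base vertex give a retraction
(`exists_cochain_of_ker_le`).

*Uniqueness.*  Two connections with the same `ρ` differ by an unframed 1-cocycle that vanishes on
the `γ s` and `a s`, hence on all cycles, so it is a coboundary, which is a gauge transformation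
(`gaugeEquivalent_of_isVariation`).  When the holonomies of all framed closed paths at a base
vertex agree, the same follows by comparing holonomies along framed paths from that vertex.
-/

namespace DiscreteConnection

universe u v

variable {V : Type u}

/-! ### Cochains and boundaries -/

/-- The homomorphism on integral chains that extends a function `f` on the generators: the
`A`-valued cochain with values `f`. -/
noncomputable def cochain {X : Type*} {A : Type*} [AddCommGroup A] (f : X → A) :
    (X →₀ ℤ) →+ A :=
  Finsupp.liftAddHom fun x => zmultiplesHom A (f x)

@[simp]
theorem cochain_single {X : Type*} {A : Type*} [AddCommGroup A] (f : X → A) (x : X) (c : ℤ) :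
    cochain f (Finsupp.single x c) = c • f x := by
  simp [cochain]

theorem boundary_single (q : ℕ) (w : Fin (q + 1) → V) (c : ℤ) :
    boundary V q (Finsupp.single w c) =
      ∑ r : Fin (q + 1), Finsupp.single (w ∘ r.succAbove) ((-1 : ℤ) ^ (r : ℕ) * c) := by
  simp [boundary, AddMonoidHom.finsetSum_apply]

/-- The ordered simplex `[v]` of dimension zero. -/
noncomputable abbrev point (v : V) : (Fin 1 → V) →₀ ℤ := Finsupp.single (fun _ => v) 1

theorem boundary_single_two (w : Fin 2 → V) :
    boundary V 1 (Finsupp.single w 1) = point (w 1) - point (w 0) := by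
  have h0 : w ∘ (0 : Fin 2).succAbove = fun _ => w 1 := by
    funext i; fin_cases i; rfl
  have h1 : w ∘ (1 : Fin 2).succAbove = fun _ => w 0 := by
    funext i; fin_cases i; rfl
  rw [boundary_single, Fin.sum_univ_two, h0, h1]
  simp [sub_eq_add_neg]

theorem boundary_single_three (w : Fin 3 → V) :
    boundary V 2 (Finsupp.single w 1) = Finsupp.single ![w 1, w 2] 1
      - Finsupp.single ![w 0, w 2] 1 + Finsupp.single ![w 0, w 1] 1 := by
  have h0 : w ∘ (0 : Fin 3).succAbove = ![w 1, w 2] := by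
    funext i; fin_cases i <;> rfl
  have h1 : w ∘ (1 : Fin 3).succAbove = ![w 0, w 2] := by
    funext i; fin_cases i <;> rfl
  have h2 : w ∘ (2 : Fin 3).succAbove = ![w 0, w 1] := by
    funext i; fin_cases i <;> rfl
  rw [boundary_single, Fin.sum_univ_three, h0, h1, h2]
  simp [sub_eq_add_neg]

theorem boundary_single_four (w : Fin 4 → V) :
    boundary V 3 (Finsupp.single w 1) = Finsupp.single ![w 1, w 2, w 3] 1
      - Finsupp.single ![w 0, w 2, w 3] 1 + Finsupp.single ![w 0, w 1, w 3] 1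
      - Finsupp.single ![w 0, w 1, w 2] 1 := by
  have h0 : w ∘ (0 : Fin 4).succAbove = ![w 1, w 2, w 3] := by
    funext i; fin_cases i <;> rfl
  have h1 : w ∘ (1 : Fin 4).succAbove = ![w 0, w 2, w 3] := by
    funext i; fin_cases i <;> rfl
  have h2 : w ∘ (2 : Fin 4).succAbove = ![w 0, w 1, w 3] := by
    funext i; fin_cases i <;> rfl
  have h3 : w ∘ (3 : Fin 4).succAbove = ![w 0, w 1, w 2] := by
    funext i; fin_cases i <;> rfl
  rw [boundary_single, Fin.sum_univ_four, h0, h1, h2, h3]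
  simp [sub_eq_add_neg]

section Homology

variable [DecidableEq V] {L : PreAbstractSimplicialComplex V}

theorem single_mem_chains {q : ℕ} {w : Fin q → V} (hw : w ∈ orderedSimplices L q) :
    Finsupp.single w 1 ∈ chains L q :=
  AddSubgroup.subset_closure ⟨w, hw, rfl⟩

/-- A cochain kills the boundaries if it does so on generators: it is closed and antisymmetric. -/
theorem boundaries_le_ker {A : Type*} [AddCommGroup A] {q : ℕ} (Λ : ((Fin q → V) →₀ ℤ) →+ A)
    (h1 : ∀ w ∈ orderedSimplices L (q + 1), Λ (boundary V q (Finsupp.single w 1)) = 0)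
    (h2 : ∀ w ∈ orderedSimplices L q, ∀ π : Equiv.Perm (Fin q),
      Λ (Finsupp.single (w ∘ π) 1) = Λ (Finsupp.single w ((Equiv.Perm.sign π : ℤˣ) : ℤ))) :
    boundaries L q ≤ Λ.ker := by
  refine sup_le ?_ ?_
  · rw [AddSubgroup.map_le_iff_le_comap, chains, AddSubgroup.closure_le]
    rintro _ ⟨w, hw, rfl⟩
    exact h1 w hw
  · rw [orientationRelations, AddSubgroup.closure_le]
    rintro _ ⟨w, hw, π, rfl⟩
    simp [AddMonoidHom.mem_ker, h2 w hw π]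

theorem orientationRelations_one (L : PreAbstractSimplicialComplex V) :
    orientationRelations L 1 = ⊥ := by
  rw [orientationRelations, AddSubgroup.closure_eq_bot_iff]
  rintro _ ⟨w, -, π, rfl⟩
  rw [Subsingleton.elim π 1]
  simp

theorem point_mem_chains {v : V} (hv : {v} ∈ L) : point v ∈ chains L 1 :=
  single_mem_chains ⟨Function.injective_of_subsingleton _, Or.inr (by simpa using hv)⟩

theorem image_univ_two (w : Fin 2 → V) : Finset.univ.image w = {w 0, w 1} := by
  ext x; simp [Fin.exists_fin_two, eq_comm]

theorem image_univ_three (w : Fin 3 → V) : Finset.univ.image w = {w 0, w 1, w 2} := by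
  ext x; simp [Fin.exists_fin_succ, eq_comm]

theorem mem_orderedSimplices_two {w : Fin 2 → V} :
    w ∈ orderedSimplices L 2 ↔ w 0 ≠ w 1 ∧ {w 0, w 1} ∈ L := by
  rw [orderedSimplices, Set.mem_ofPred_eq, image_univ_two]
  refine and_congr ⟨fun h => h.ne (by decide), fun h => ?_⟩ (by simp)
  intro i j hij
  fin_cases i <;> fin_cases j <;> first | rfl | exact absurd hij h | exact absurd hij.symm h

theorem mem_orderedSimplices_three {w : Fin 3 → V} :
    w ∈ orderedSimplices L 3 ↔
      w 0 ≠ w 1 ∧ w 1 ≠ w 2 ∧ w 2 ≠ w 0 ∧ {w 0, w 1, w 2} ∈ L := by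
  rw [orderedSimplices, Set.mem_ofPred_eq, image_univ_three]
  simp only [OfNat.ofNat_ne_zero, false_or, ← and_assoc]
  refine and_congr_left fun _ =>
    ⟨fun h => ⟨⟨h.ne (by decide), h.ne (by decide)⟩, h.ne (by decide)⟩, fun h => ?_⟩
  obtain ⟨⟨h1, h2⟩, h3⟩ := h
  intro i j hij
  fin_cases i <;> fin_cases j <;>
    first | rfl | exact absurd hij ‹_› | exact absurd hij.symm ‹_›

theorem pair_mem_chains {v w : V} (hne : v ≠ w) (h : {v, w} ∈ L) :
    Finsupp.single ![v, w] 1 ∈ chains L 2 :=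
  single_mem_chains (mem_orderedSimplices_two.2 ⟨hne, h⟩)

theorem cycles_le_boundaries {q : ℕ} [h : Subsingleton (ReducedHomology L q)] :
    cycles L q ≤ boundaries L q := by
  intro x hx
  have := Subsingleton.elim ((⟨x, hx⟩ : cycles L q) : ReducedHomology L q) 0
  rw [QuotientAddGroup.eq_zero_iff] at this
  exact AddSubgroup.mem_addSubgroupOf.1 this

theorem subsingleton_homology {q : ℕ} (h : cycles L q ≤ boundaries L q) :
    Subsingleton (ReducedHomology L q) := by
  rw [ReducedHomology, AddSubgroup.addSubgroupOf_eq_top.2 h]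
  exact QuotientAddGroup.subsingleton_quotient_top

/-! ### Reduced homology in low dimensions -/

/-- Vanishing of the reduced homology in dimension `-1` means that the complex is not empty. -/
theorem exists_vertex_of_homology_zero (h : Subsingleton (ReducedHomology L 0)) :
    ∃ v, {v} ∈ L := by
  by_contra! hL
  have hle : boundaries L 0 ≤ (cochain fun _ : Fin 0 → V => (1 : ℤ)).ker := by
    refine boundaries_le_ker _ ?_ ?_
    · rintro w ⟨-, hw⟩
      refine absurd (hw.resolve_left one_ne_zero) ?_
      rw [show Finset.univ.image w = {w 0} by simp]
      exact hL _
    · intro w _ π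
      rw [Subsingleton.elim π 1]
      simp
  have hmem : Finsupp.single (Fin.elim0 : Fin 0 → V) 1 ∈ cycles L 0 :=
    single_mem_chains ⟨Function.injective_of_subsingleton _, Or.inl rfl⟩
  have := hle (cycles_le_boundaries hmem)
  simp [AddMonoidHom.mem_ker] at this

/-- The augmentation of a nonempty complex is onto, so its reduced homology in dimension `-1`
vanishes. -/
theorem homology_zero_of_vertex {v : V} (hv : {v} ∈ L) :
    Subsingleton (ReducedHomology L 0) := by
  refine subsingleton_homology ?_
  change chains L 0 ≤ _
  rw [chains, AddSubgroup.closure_le]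
  rintro _ ⟨w, -, rfl⟩
  refine AddSubgroup.mem_sup_left ⟨point v, point_mem_chains hv, ?_⟩
  rw [boundary_single]
  simp [Subsingleton.elim _ w]

/-- Vanishing of the reduced homology in dimension `0` gives, for any two vertices, a chain
bounded by their difference. -/
theorem exists_chain_of_homology_one (h : Subsingleton (ReducedHomology L 1)) {v w : V}
    (hv : {v} ∈ L) (hw : {w} ∈ L) :
    ∃ c ∈ chains L 2, boundary V 1 c = point w - point v := by
  have hmem : point w - point v ∈ cycles L 1 := by
    refine ⟨(chains L 1).sub_mem (point_mem_chains hw) (point_mem_chains hv), ?_⟩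
    refine AddSubgroup.subset_closure ⟨Fin.elim0, ⟨Function.injective_of_subsingleton _,
      Or.inl rfl⟩, 1, ?_⟩
    simp only [map_sub, boundary_single]
    simp [Subsingleton.elim _ (Fin.elim0 : Fin 0 → V)]
  have := cycles_le_boundaries hmem
  rwa [boundaries, orientationRelations_one, sup_bot_eq] at this

/-- A function on the vertices that is constant along edges is constant, when the reduced
homology in dimension `0` vanishes. -/
theorem eq_of_homology_one (h : Subsingleton (ReducedHomology L 1)) {X : Type*} (f : V → X)
    (hf : ∀ v w, v ≠ w → {v, w} ∈ L → f v = f w) {v w : V} (hv : {v} ∈ L) (hw : {w} ∈ L) :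
    f v = f w := by
  classical
  obtain ⟨c, hc, hb⟩ := exists_chain_of_homology_one h hv hw
  by_contra hne
  let χ : ((Fin 1 → V) →₀ ℤ) →+ ℤ := cochain fun x => if f (x 0) = f v then 1 else 0
  have hle : chains L 2 ≤ (χ.comp (boundary V 1)).ker := by
    rw [chains, AddSubgroup.closure_le]
    rintro _ ⟨x, hx, rfl⟩
    obtain ⟨h1, h2⟩ := mem_orderedSimplices_two.1 hx
    simp [AddMonoidHom.mem_ker, boundary_single_two, χ, hf _ _ h1 h2]
  have := hle hc
  simp [AddMonoidHom.mem_ker, hb, χ, Ne.symm hne] at this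

/-- If every vertex is joined to `v₀` by a chain, a 1-cochain that vanishes on all cycles is the
coboundary of the function whose value at `v` is minus that of the cochain on the chosen chain
from `v₀` to `v`. -/
theorem exists_potential_of_cycles {A : Type*} [AddCommGroup A] (l : V → V → A) {v₀ : V}
    (hc : ∀ v, {v} ∈ L → ∃ c ∈ chains L 2, boundary V 1 c = point v - point v₀)
    (hl : ∀ x ∈ cycles L 2, cochain (fun w : Fin 2 → V => l (w 0) (w 1)) x = 0) :
    ∃ g : V → A, ∀ v w, v ≠ w → {v, w} ∈ L → l v w = g v - g w := by
  choose! c hcL hcb using hc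
  refine ⟨fun v => - cochain (fun w : Fin 2 → V => l (w 0) (w 1)) (c v), fun v w hne h => ?_⟩
  have hv : {v} ∈ L := (L.isRelLowerSet_faces h).2 (by simp) (by simp)
  have hw : {w} ∈ L := (L.isRelLowerSet_faces h).2 (by simp) (by simp)
  have := hl (c v + Finsupp.single ![v, w] 1 - c w)
    ⟨(chains L 2).sub_mem ((chains L 2).add_mem (hcL v hv) (pair_mem_chains hne h)) (hcL w hw), by
      refine AddSubgroup.mem_comap.2 ?_
      simp only [map_sub, map_add, hcb v hv, hcb w hw, boundary_single_two]
      simp⟩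
  simp only [map_add, map_sub, cochain_single] at this
  simp only [Matrix.cons_val_zero, Matrix.cons_val_one, one_smul] at this
  rw [neg_sub_neg, ← sub_eq_zero, ← this]
  abel

theorem perm_fin_two (π : Equiv.Perm (Fin 2)) : π = 1 ∨ π = Equiv.swap 0 1 := by
  revert π; decide

/-- A 1-cocycle vanishes on boundaries. -/
theorem boundaries_two_le_ker {A : Type*} [AddCommGroup A] (l : V → V → A)
    (hanti : ∀ v w, v ≠ w → {v, w} ∈ L → l v w + l w v = 0)
    (htri : ∀ x y z, x ≠ y → y ≠ z → z ≠ x → {x, y, z} ∈ L → l x y + l y z + l z x = 0) :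
    boundaries L 2 ≤ (cochain fun w : Fin 2 → V => l (w 0) (w 1)).ker := by
  refine boundaries_le_ker _ (fun w hw => ?_) (fun w hw π => ?_)
  · obtain ⟨h1, h2, h3, h⟩ := mem_orderedSimplices_three.1 hw
    have h4 := hanti _ _ h3 ((L.isRelLowerSet_faces h).2
      (by intro x; simp only [Finset.mem_insert, Finset.mem_singleton]; tauto) (by simp))
    have h5 := htri _ _ _ h1 h2 h3 h
    simp only [boundary_single_three, map_add, map_sub, cochain_single, one_smul,
      Matrix.cons_val_zero, Matrix.cons_val_one]
    rw [← sub_eq_zero.2 (h5.trans h4.symm)]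
    abel
  · obtain ⟨h1, h⟩ := mem_orderedSimplices_two.1 hw
    rcases perm_fin_two π with rfl | rfl
    · simp
    · have := hanti _ _ h1 h
      simpa using eq_neg_of_add_eq_zero_right this

/-- A 1-cocycle is a coboundary when the reduced homology vanishes in dimensions `0` and `1`. -/
theorem exists_potential_of_homology {A : Type*} [AddCommGroup A]
    (h1 : Subsingleton (ReducedHomology L 1)) (h2 : Subsingleton (ReducedHomology L 2))
    (l : V → V → A) (hanti : ∀ v w, v ≠ w → {v, w} ∈ L → l v w + l w v = 0)
    (htri : ∀ x y z, x ≠ y → y ≠ z → z ≠ x → {x, y, z} ∈ L → l x y + l y z + l z x = 0) :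
    ∃ g : V → A, ∀ v w, v ≠ w → {v, w} ∈ L → l v w = g v - g w := by
  by_cases hL : ∃ v₀, {v₀} ∈ L
  · obtain ⟨v₀, hv₀⟩ := hL
    exact exists_potential_of_cycles l (fun v hv => exists_chain_of_homology_one h1 hv₀ hv)
      fun x hx => boundaries_two_le_ker l hanti htri (cycles_le_boundaries hx)
  · exact ⟨0, fun v w _ h => absurd ⟨v, (L.isRelLowerSet_faces h).2 (by simp) (by simp)⟩ hL⟩

/-- A discrete complex whose reduced homology in dimension `0` is infinite cyclic has at most two
vertices. -/
theorem card_vertices_of_homology_one (e : Nonempty (ReducedHomology L 1 ≃+ ℤ))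
    (hL : ∀ v w, v ≠ w → {v, w} ∉ L) {a b c : V} (ha : {a} ∈ L) (hb : {b} ∈ L) (hc : {c} ∈ L)
    (hab : a ≠ b) (hac : a ≠ c) : b = c := by
  obtain ⟨e⟩ := e
  by_contra hbc
  have hcyc : ∀ {v}, {v} ∈ L → point v - point a ∈ cycles L 1 := by
    intro v hv
    refine ⟨(chains L 1).sub_mem (point_mem_chains hv) (point_mem_chains ha), ?_⟩
    refine AddSubgroup.subset_closure ⟨Fin.elim0, ⟨Function.injective_of_subsingleton _,
      Or.inl rfl⟩, 1, ?_⟩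
    simp only [map_sub, boundary_single]
    simp [Subsingleton.elim _ (Fin.elim0 : Fin 0 → V)]
  -- As there are no edges, coordinates of chains are well defined on homology classes.
  have hker : ∀ v : V, boundaries L 1 ≤
      (cochain fun w : Fin 1 → V => if w 0 = v then (1 : ℤ) else 0).ker := by
    refine fun v => boundaries_le_ker _ (fun w hw => ?_) (fun w _ π => ?_)
    · obtain ⟨h1, h2⟩ := mem_orderedSimplices_two.1 hw
      exact absurd h2 (hL _ _ h1)
    · rw [Subsingleton.elim π 1]; simp
  let X : cycles L 1 := ⟨_, hcyc hb⟩
  let Y : cycles L 1 := ⟨_, hcyc hc⟩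
  have hrel : e (e (Y : ReducedHomology L 1) • (X : ReducedHomology L 1) -
      e (X : ReducedHomology L 1) • (Y : ReducedHomology L 1)) = 0 := by
    simp only [map_sub, map_zsmul, smul_eq_mul]
    ring
  have hmem : ∀ x : cycles L 1, e (x : ReducedHomology L 1) = 0 → (x : _ →₀ ℤ) ∈ boundaries L 1 := by
    intro x hx
    rw [map_eq_zero_iff e e.injective, QuotientAddGroup.eq_zero_iff] at hx
    exact AddSubgroup.mem_addSubgroupOf.1 hx
  have hB := hmem (e (Y : ReducedHomology L 1) • X - e (X : ReducedHomology L 1) • Y) hrel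
  have hX : e (X : ReducedHomology L 1) = 0 := by
    have := hker c hB
    simpa [AddMonoidHom.mem_ker, X, Y, hbc, hac] using this
  have := hker b (hmem X hX)
  simp [AddMonoidHom.mem_ker, X, hab] at this

end Homology

/-! ### Links and stars in a triangulated manifold -/

section Manifold

variable {K : AbstractSimplicialComplex V} {n : ℕ}

theorem mem_of_subset {σ τ : Finset V} (h : σ ∈ K) (hle : τ ⊆ σ) (hne : τ.Nonempty) : τ ∈ K :=
  (K.isRelLowerSet_faces h).2 hle hne

theorem Facet.eq_of_subset {T T' : Facet K n} (h : T.1 ⊆ T'.1) : T = T' :=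
  Subtype.ext (Finset.eq_of_subset_of_card_le h (by rw [T.2.2, T'.2.2]))

variable [DecidableEq V]

theorem mem_link {σ τ : Finset V} :
    τ ∈ link K σ ↔ τ.Nonempty ∧ Disjoint σ τ ∧ σ ∪ τ ∈ K := Iff.rfl

theorem singleton_mem_link {σ : Finset V} {v : V} :
    {v} ∈ link K σ ↔ v ∉ σ ∧ insert v σ ∈ K := by
  rw [mem_link, Finset.disjoint_singleton_right, Finset.union_comm, ← Finset.insert_eq]
  simp

theorem pair_mem_link {σ : Finset V} {v w : V} :
    {v, w} ∈ link K σ ↔ v ∉ σ ∧ w ∉ σ ∧ insert v (insert w σ) ∈ K := by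
  rw [mem_link, Finset.disjoint_insert_right, Finset.disjoint_singleton_right, Finset.union_comm,
    Finset.insert_union, ← Finset.insert_eq]
  simp [and_assoc]

theorem triple_mem_link {σ : Finset V} {x y z : V} : {x, y, z} ∈ link K σ ↔
    x ∉ σ ∧ y ∉ σ ∧ z ∉ σ ∧ insert x (insert y (insert z σ)) ∈ K := by
  rw [mem_link, Finset.disjoint_insert_right, Finset.disjoint_insert_right,
    Finset.disjoint_singleton_right, Finset.union_comm, Finset.insert_union, Finset.insert_union,
    ← Finset.insert_eq]
  simp [and_assoc]

theorem IsTriangulatedManifold.exists_insert (hK : IsTriangulatedManifold K n) {σ : Finset V}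
    (hσ : σ ∈ K) (hc : σ.card ≠ n + 1) : ∃ v ∉ σ, insert v σ ∈ K := by
  obtain ⟨v, hv⟩ := exists_vertex_of_homology_zero ((hK σ hσ 0).2 (by omega))
  exact ⟨v, singleton_mem_link.1 hv⟩

/-- The simplices of dimension `n` are maximal: the homology of their link in dimension `-1` does
not vanish. -/
theorem IsTriangulatedManifold.insert_notMem (hK : IsTriangulatedManifold K n) {σ : Finset V}
    (hσ : σ ∈ K) (hc : σ.card = n + 1) {v : V} (hv : v ∉ σ) : insert v σ ∉ K := by
  intro h
  obtain ⟨e⟩ := (hK σ hσ 0).1 (by omega)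
  have := homology_zero_of_vertex (singleton_mem_link.2 ⟨hv, h⟩)
  exact zero_ne_one (e.symm.injective (Subsingleton.elim (e.symm 0) (e.symm 1)))

theorem IsTriangulatedManifold.card_le (hK : IsTriangulatedManifold K n) {σ : Finset V}
    (hσ : σ ∈ K) : σ.card ≤ n + 1 := by
  by_contra! hlt
  obtain ⟨τ, hτ, hcard⟩ := Finset.exists_subset_card_eq hlt.le
  obtain ⟨v, hv, hvτ⟩ : ∃ v ∈ σ, v ∉ τ := by
    by_contra! h
    have := Finset.card_le_card (show σ ⊆ τ from h)
    omega
  have hτK : τ ∈ K := mem_of_subset hσ hτ (Finset.card_pos.1 (by omega))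
  exact hK.insert_notMem hτK hcard hvτ
    (mem_of_subset hσ (Finset.insert_subset hv hτ) (Finset.insert_nonempty _ _))

/-- A triangulated manifold is pure: every simplex is a face of an `n`-simplex. -/
theorem IsTriangulatedManifold.exists_facet (hK : IsTriangulatedManifold K n) {σ : Finset V}
    (hσ : σ ∈ K) : ∃ T : Facet K n, σ ⊆ T.1 := by
  induction hd : n + 1 - σ.card generalizing σ with
  | zero =>
    have := hK.card_le hσ
    exact ⟨⟨σ, hσ, by omega⟩, subset_rfl⟩
  | succ d ih =>
    obtain ⟨v, hv, hvK⟩ := hK.exists_insert hσ (by omega)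
    obtain ⟨T, hT⟩ := ih hvK (by rw [Finset.card_insert_of_notMem hv]; omega)
    exact ⟨T, (Finset.subset_insert _ _).trans hT⟩

/-- Links of simplices of codimension at least two are connected. -/
theorem IsTriangulatedManifold.link_eq (hK : IsTriangulatedManifold K n) {σ : Finset V}
    (hσ : σ ∈ K) (hc : σ.card ≠ n) {X : Type*} (f : V → X)
    (hf : ∀ v w, v ∉ σ → w ∉ σ → insert v (insert w σ) ∈ K → f v = f w) {v w : V}
    (hv : v ∉ σ) (hw : w ∉ σ) (hvK : insert v σ ∈ K) (hwK : insert w σ ∈ K) : f v = f w :=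
  eq_of_homology_one ((hK σ hσ 1).2 (by omega)) f
    (fun v w _ h => hf v w (pair_mem_link.1 h).1 (pair_mem_link.1 h).2.1 (pair_mem_link.1 h).2.2)
    (singleton_mem_link.2 ⟨hv, hvK⟩) (singleton_mem_link.2 ⟨hw, hwK⟩)

theorem Facet.exists_notMem (T : Facet K n) {σ : Finset V} (hc : σ.card ≤ n) :
    ∃ v ∈ T.1, v ∉ σ := by
  by_contra! h
  have := Finset.card_le_card (show T.1 ⊆ σ from h)
  have := T.2.2
  omega

theorem Facet.insert_mem (T : Facet K n) {σ : Finset V} {v : V} (hσ : σ ⊆ T.1) (hv : v ∈ T.1) :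
    insert v σ ∈ K :=
  mem_of_subset T.2.1 (Finset.insert_subset hv hσ) (Finset.insert_nonempty _ _)

theorem dualGraph_adj_of_subset {T T' : Facet K n} (hne : T ≠ T') {σ : Finset V} (hc : n ≤ σ.card)
    (hT : σ ⊆ T.1) (hT' : σ ⊆ T'.1) : (dualGraph K n).Adj T T' := by
  refine ⟨hne, le_antisymm ?_ (hc.trans (Finset.card_le_card (Finset.subset_inter hT hT')))⟩
  by_contra! hlt
  have h := Finset.eq_of_subset_of_card_le (Finset.inter_subset_left (s₁ := T.1) (s₂ := T'.1))
    (by rw [T.2.2]; omega)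
  exact hne (Facet.eq_of_subset (Finset.inter_eq_left.1 h))

/-- Stars are strongly connected: a function on the `n`-simplices around `σ` that takes equal
values on neighbours is constant. -/
theorem IsTriangulatedManifold.star_eq (hK : IsTriangulatedManifold K n) {σ : Finset V}
    (hσ : σ ∈ K) {X : Type*} (f : Facet K n → X)
    (hf : ∀ T T', (dualGraph K n).Adj T T' → σ ⊆ T.1 → σ ⊆ T'.1 → f T = f T')
    {T T' : Facet K n} (hT : σ ⊆ T.1) (hT' : σ ⊆ T'.1) : f T = f T' := by
  induction hd : n - σ.card generalizing σ T T' with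
  | zero =>
    rcases eq_or_ne T T' with rfl | hne
    · rfl
    · exact hf _ _ (dualGraph_adj_of_subset hne (by omega) hT hT') hT hT'
  | succ d ih =>
    have hstar : ∀ {v : V} {T T' : Facet K n}, v ∉ σ → insert v σ ⊆ T.1 → insert v σ ⊆ T'.1 →
        f T = f T' := fun {v T T'} hv h h' =>
      ih (mem_of_subset T.2.1 h (Finset.insert_nonempty _ _))
        (fun T T' hadj h1 h2 => hf T T' hadj ((Finset.subset_insert _ _).trans h1)
          ((Finset.subset_insert _ _).trans h2)) h h'
        (by rw [Finset.card_insert_of_notMem hv]; omega)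
    -- For a vertex `v` of the link, `F v` is the common value on the star of `σ ∪ {v}`.
    have : Nonempty (Facet K n) := ⟨T⟩
    have hF : ∀ v, v ∉ σ ∧ insert v σ ∈ K → ∃ T : Facet K n, insert v σ ⊆ T.1 :=
      fun v hv => hK.exists_facet hv.2
    choose! F hF using hF
    obtain ⟨v, hvT, hv⟩ := T.exists_notMem (σ := σ) (by omega)
    obtain ⟨w, hwT, hw⟩ := T'.exists_notMem (σ := σ) (by omega)
    have hvK := T.insert_mem hT hvT
    have hwK := T'.insert_mem hT' hwT
    have key : f (F v) = f (F w) := by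
      refine hK.link_eq hσ (by omega) (fun v => f (F v)) (fun v w hv hw h => ?_) hv hw hvK hwK
      obtain ⟨S, hS⟩ := hK.exists_facet h
      have h1 : insert v σ ⊆ S.1 :=
        (Finset.insert_subset_insert _ (Finset.subset_insert _ _)).trans hS
      have h2 : insert w σ ⊆ S.1 := (Finset.subset_insert _ _).trans hS
      have hvK := mem_of_subset S.2.1 h1 (Finset.insert_nonempty _ _)
      have hwK := mem_of_subset S.2.1 h2 (Finset.insert_nonempty _ _)
      exact (hstar hv (hF v ⟨hv, hvK⟩) h1).trans (hstar hw h2 (hF w ⟨hw, hwK⟩))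
    exact (hstar hv (Finset.insert_subset hvT hT) (hF v ⟨hv, hvK⟩)).trans
      (key.trans (hstar hw (hF w ⟨hw, hwK⟩) (Finset.insert_subset hwT hT')))

/-- At most two `n`-simplices share a face of dimension `n - 1`. -/
theorem IsTriangulatedManifold.eq_of_common_face (hK : IsTriangulatedManifold K n) {σ : Finset V}
    (hσ : σ ∈ K) (hc : σ.card = n) {S T T' : Facet K n} (hS : σ ⊆ S.1) (hT : σ ⊆ T.1)
    (hT' : σ ⊆ T'.1) (h : S ≠ T) (h' : S ≠ T') : T = T' := by
  have hex : ∀ T : Facet K n, σ ⊆ T.1 → ∃ v, v ∉ σ ∧ T.1 = insert v σ := by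
    intro T hT
    obtain ⟨v, hvT, hv⟩ := T.exists_notMem hc.le
    refine ⟨v, hv, (Finset.eq_of_subset_of_card_le (Finset.insert_subset hvT hT) ?_).symm⟩
    rw [T.2.2, Finset.card_insert_of_notMem hv, hc]
  obtain ⟨a, ha, hSa⟩ := hex S hS
  obtain ⟨b, hb, hTb⟩ := hex T hT
  obtain ⟨c, hc', hTc⟩ := hex T' hT'
  have hbc : b = c := by
    refine card_vertices_of_homology_one (L := link K σ) ((hK σ hσ 1).1 (by omega)) ?_
      (singleton_mem_link.2 ⟨ha, hSa ▸ S.2.1⟩) (singleton_mem_link.2 ⟨hb, hTb ▸ T.2.1⟩)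
      (singleton_mem_link.2 ⟨hc', hTc ▸ T'.2.1⟩) ?_ ?_
    · intro v w hne hvw
      obtain ⟨hv, hw, hK'⟩ := pair_mem_link.1 hvw
      have := hK.card_le hK'
      rw [Finset.card_insert_of_notMem (by simp [hne, hv]), Finset.card_insert_of_notMem hw] at this
      omega
    · rintro rfl; exact h (Subtype.ext (hSa.trans hTb.symm))
    · rintro rfl; exact h' (Subtype.ext (hSa.trans hTc.symm))
  exact Subtype.ext (by rw [hTb, hTc, hbc])

end Manifold

/-! ### Sums along walks -/

/-- The sum of the values `r x y` over the darts of a walk. -/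
def walkSum {X A : Type*} [AddCommGroup A] {G : SimpleGraph X} (r : X → X → A) {x y : X}
    (w : G.Walk x y) : A :=
  (w.darts.map fun d => r d.fst d.snd).sum

section Walk

variable {X A : Type*} [AddCommGroup A] {G : SimpleGraph X} (r : X → X → A)

@[simp]
theorem walkSum_nil (x : X) : walkSum r (.nil : G.Walk x x) = 0 := rfl

@[simp]
theorem walkSum_cons {x y z : X} (h : G.Adj x y) (w : G.Walk y z) :
    walkSum r (.cons h w) = r x y + walkSum r w := by
  simp [walkSum]

@[simp]
theorem walkSum_append {x y z : X} (w : G.Walk x y) (w' : G.Walk y z) :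
    walkSum r (w.append w') = walkSum r w + walkSum r w' := by
  simp [walkSum]

/-- The sum of a difference telescopes. -/
theorem walkSum_eq_sub {S : Set X} {g : X → A}
    (hg : ∀ x y, G.Adj x y → x ∈ S → y ∈ S → r x y = g x - g y) {x y : X} (w : G.Walk x y)
    (hw : ∀ z ∈ w.support, z ∈ S) : walkSum r w = g x - g y := by
  induction w with
  | nil => simp
  | cons h w ih =>
    simp only [SimpleGraph.Walk.support_cons, List.mem_cons, forall_eq_or_imp] at hw
    rw [walkSum_cons, ih hw.2, hg _ _ h hw.1 (hw.2 _ w.start_mem_support)]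
    abel

variable {S : Set X} (hr : ∀ x y, G.Adj x y → x ∈ S → y ∈ S → r x y + r y x = 0)
include hr

theorem walkSum_reverse {x y : X} (w : G.Walk x y) (hw : ∀ z ∈ w.support, z ∈ S) :
    walkSum r w.reverse = - walkSum r w := by
  induction w with
  | nil => simp
  | cons h w ih =>
    simp only [SimpleGraph.Walk.support_cons, List.mem_cons, forall_eq_or_imp] at hw
    have := hr _ _ h hw.1 (hw.2 _ w.start_mem_support)
    rw [SimpleGraph.Walk.reverse_cons, walkSum_append, ih hw.2, walkSum_cons, walkSum_cons,
      walkSum_nil, eq_neg_of_add_eq_zero_right this]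
    abel

/-- Cutting the loops out of a walk does not change its sum, if the sums over cycles vanish. -/
theorem walkSum_bypass [DecidableEq X]
    (hc : ∀ x (w : G.Walk x x), w.IsCycle → (∀ z ∈ w.support, z ∈ S) → walkSum r w = 0)
    {x y : X} (w : G.Walk x y) (hw : ∀ z ∈ w.support, z ∈ S) :
    walkSum r w.bypass = walkSum r w := by
  induction w with
  | nil => rfl
  | @cons x y z h w ih =>
    simp only [SimpleGraph.Walk.support_cons, List.mem_cons, forall_eq_or_imp] at hw
    rw [walkSum_cons, ← ih hw.2]
    simp only [SimpleGraph.Walk.bypass]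
    split_ifs with hx
    · have hsum : walkSum r w.bypass = walkSum r (w.bypass.takeUntil x hx) +
          walkSum r (w.bypass.dropUntil x hx) := by
        rw [← walkSum_append, SimpleGraph.Walk.take_spec]
      have hpath := w.bypass_isPath.takeUntil hx
      have hsup : ∀ t ∈ (w.bypass.takeUntil x hx).support, t ∈ S := fun t ht =>
        hw.2 _ (w.support_bypass_subset_support (w.bypass.support_takeUntil_subset_support hx ht))
      have hzero : r x y + walkSum r (w.bypass.takeUntil x hx) = 0 := by
        generalize w.bypass.takeUntil x hx = p at hpath hsup
        by_cases he : s(x, y) ∈ p.edges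
        · -- a path from `y` to `x` through the edge between them is that edge
          cases p with
          | nil => exact absurd rfl h.ne
          | @cons _ t _ h' p =>
            rw [SimpleGraph.Walk.cons_isPath_iff] at hpath
            rw [SimpleGraph.Walk.edges_cons, List.mem_cons] at he
            rcases he with he | he
            · rw [Sym2.eq_swap, Sym2.congr_right] at he
              subst he
              rw [(SimpleGraph.Walk.isPath_iff_nil.1 hpath.1).eq_nil]
              simpa using hr _ _ h hw.1 (hw.2 _ w.start_mem_support)
            · exact absurd (p.snd_mem_support_of_mem_edges he) hpath.2
        · have := hc x (.cons h p) (SimpleGraph.Walk.cons_isCycle_iff p h |>.2 ⟨hpath, he⟩) (by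
            simpa using ⟨hw.1, hsup⟩)
          simpa using this
      rw [hsum, ← add_assoc, hzero, zero_add]
    · rw [walkSum_cons]

/-- Sums over closed walks vanish if those over cycles do: a closed walk without loops is trivial. -/
theorem walkSum_eq_zero
    (hc : ∀ x (w : G.Walk x x), w.IsCycle → (∀ z ∈ w.support, z ∈ S) → walkSum r w = 0)
    {x : X} (w : G.Walk x x) (hw : ∀ z ∈ w.support, z ∈ S) : walkSum r w = 0 := by
  classical
  rw [← walkSum_bypass r hr hc w hw, (SimpleGraph.Walk.isPath_iff_nil.1 w.bypass_isPath).eq_nil,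
    walkSum_nil]

end Walk

/-! ### Potentials on stars -/

section Manifold

variable [DecidableEq V] {K : AbstractSimplicialComplex V} {n : ℕ} {A : Type*} [AddCommGroup A]

/-- `r` is the difference of a function on the `n`-simplices around `σ`, as far as neighbours are
concerned. -/
def HasPotential (r : Facet K n → Facet K n → A) (σ : Finset V) : Prop :=
  ∃ g : Facet K n → A, ∀ T T', (dualGraph K n).Adj T T' → σ ⊆ T.1 → σ ⊆ T'.1 →
    r T T' = g T - g T'

/-- If the sums of `r` over cycles in the star of `σ` vanish, then the sums along walks from a fixed
`n`-simplex of the star define a potential. -/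
theorem IsTriangulatedManifold.hasPotential_of_cycles (hK : IsTriangulatedManifold K n)
    {σ : Finset V} (hσ : σ ∈ K) (r : Facet K n → Facet K n → A)
    (hr : ∀ T T', (dualGraph K n).Adj T T' → σ ⊆ T.1 → σ ⊆ T'.1 → r T T' + r T' T = 0)
    (hc : ∀ (T : Facet K n) (w : (dualGraph K n).Walk T T), w.IsCycle → InStar σ w →
      walkSum r w = 0) : HasPotential r σ := by
  obtain ⟨T₀, hT₀⟩ := hK.exists_facet hσ
  have hw : ∀ T : Facet K n, σ ⊆ T.1 → ∃ w : (dualGraph K n).Walk T₀ T, InStar σ w := by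
    intro T hT
    refine (hK.star_eq hσ (fun T => ∃ w : (dualGraph K n).Walk T₀ T, InStar σ w) ?_ hT₀ hT).mp
      ⟨.nil, by simpa [InStar] using hT₀⟩
    intro T T' h hT hT'
    refine propext ⟨fun ⟨w, hw⟩ => ⟨w.concat h, ?_⟩, fun ⟨w, hw⟩ => ⟨w.concat h.symm, ?_⟩⟩ <;>
    · intro X hX
      rw [SimpleGraph.Walk.support_concat, List.mem_append,
        List.mem_singleton] at hX
      rcases hX with hX | rfl
      · exact hw X hX
      · assumption
  choose w hw using hw
  classical
  refine ⟨fun T => if hT : σ ⊆ T.1 then - walkSum r (w T hT) else 0, fun T T' h hT hT' => ?_⟩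
  have := walkSum_eq_zero (S := {T : Facet K n | σ ⊆ T.1}) r hr hc
    ((w T hT).append (.cons h (w T' hT').reverse)) (by
      intro z hz
      simp only [SimpleGraph.Walk.mem_support_append_iff, SimpleGraph.Walk.support_cons,
        SimpleGraph.Walk.support_reverse, List.mem_cons, List.mem_reverse] at hz
      rcases hz with hz | rfl | hz
      · exact hw _ _ z hz
      · exact hT
      · exact hw _ _ z hz)
  rw [walkSum_append, walkSum_cons, walkSum_reverse (S := {T : Facet K n | σ ⊆ T.1}) r hr _
    (hw T' hT')] at this
  simp only [dif_pos hT, dif_pos hT']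
  rw [neg_sub_neg, ← sub_eq_zero, ← this]
  abel

/-- Around a simplex of dimension `n - 1` a potential exists trivially, as there are at most two
`n`-simplices. -/
theorem IsTriangulatedManifold.hasPotential_of_card_eq (hK : IsTriangulatedManifold K n)
    {σ : Finset V} (hσ : σ ∈ K) (hcard : σ.card = n) (r : Facet K n → Facet K n → A)
    (hr : ∀ T T', (dualGraph K n).Adj T T' → σ ⊆ T.1 → σ ⊆ T'.1 → r T T' + r T' T = 0) :
    HasPotential r σ := by
  classical
  obtain ⟨T₀, hT₀⟩ := hK.exists_facet hσ
  refine ⟨fun T => if T = T₀ then 0 else r T T₀, fun T T' h hT hT' => ?_⟩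
  by_cases h0 : T = T₀
  · subst h0
    simpa [h.ne.symm] using eq_neg_of_add_eq_zero_left (hr _ _ h hT hT')
  · by_cases h1 : T' = T₀
    · subst h1; simp [h0]
    · exact absurd (hK.eq_of_common_face hσ hcard hT₀ hT hT' (Ne.symm h0) (Ne.symm h1)) h.ne

/-- Potentials around the simplices of dimension `n - 2` extend to potentials around all their
faces: the potentials `G v` on the stars of `σ ∪ {v}` differ by constants, which form a 1-cocycle
on the link of `σ`, and the first homology of the link vanishes. -/
theorem IsTriangulatedManifold.hasPotential_of_codim_two (hK : IsTriangulatedManifold K n)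
    (r : Facet K n → Facet K n → A) {σ₀ σ : Finset V}
    (hB : ∀ τ ∈ K, τ.card = n - 1 → σ₀ ⊆ τ → HasPotential r τ)
    (hσ : σ ∈ K) (hσ₀ : σ₀ ⊆ σ) (hcard : σ.card ≤ n - 1) : HasPotential r σ := by
  induction hd : n - 1 - σ.card generalizing σ with
  | zero => exact hB σ hσ (by omega) hσ₀
  | succ d ih =>
    have hG : ∀ v, v ∉ σ ∧ insert v σ ∈ K → HasPotential r (insert v σ) := by
      rintro v ⟨hv, hvK⟩
      have := Finset.card_insert_of_notMem hv
      exact ih hvK (hσ₀.trans (Finset.subset_insert _ _)) (by omega) (by omega)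
    choose! G hG using hG
    have hF : ∀ v w, insert v (insert w σ) ∈ K →
        ∃ T : Facet K n, insert v (insert w σ) ⊆ T.1 := fun v w h => hK.exists_facet h
    have : Nonempty (Facet K n) := (hK.exists_facet hσ).nonempty
    choose! F hF using hF
    -- By strong connectivity of the star of `σ ∪ {v, w}`, `G v - G w` has the constant value `l v w`
    -- on it.
    let l : V → V → A := fun v w => G v (F v w) - G w (F v w)
    have hl : ∀ (T : Facet K n) (v w), v ∉ σ → w ∉ σ → v ∈ T.1 → w ∈ T.1 → σ ⊆ T.1 →
        G v T - G w T = l v w := by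
      intro T v w hv hw hvT hwT hT
      have hT' : insert v (insert w σ) ⊆ T.1 :=
        Finset.insert_subset hvT (Finset.insert_subset hwT hT)
      have hmem : insert v (insert w σ) ∈ K := T.insert_mem (Finset.insert_subset hwT hT) hvT
      refine hK.star_eq hmem (fun T => G v T - G w T) ?_ hT' (hF _ _ hmem)
      intro S S' hadj hS hS'
      have hsub : insert w σ ⊆ insert v (insert w σ) := Finset.subset_insert _ _
      have hsub' : insert v σ ⊆ insert v (insert w σ) :=
        Finset.insert_subset_insert _ (Finset.subset_insert _ _)
      have h1 := hG v ⟨hv, T.insert_mem hT hvT⟩ S S' hadj (hsub'.trans hS) (hsub'.trans hS')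
      have h2 := hG w ⟨hw, T.insert_mem hT hwT⟩ S S' hadj (hsub.trans hS) (hsub.trans hS')
      rw [h1] at h2
      rw [sub_eq_sub_iff_add_eq_add] at h2 ⊢
      rw [add_comm (G v S), add_comm (G v S'), ← h2, add_comm]
    obtain ⟨g, hg⟩ := exists_potential_of_homology (L := link K σ) ((hK σ hσ 1).2 (by omega))
      ((hK σ hσ 2).2 (by omega)) l
      (by
        intro v w _ h
        obtain ⟨hv, hw, hK'⟩ := pair_mem_link.1 h
        obtain ⟨T, hT⟩ := hK.exists_facet hK'
        simp only [Finset.insert_subset_iff] at hT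
        rw [← hl T v w hv hw hT.1 hT.2.1 hT.2.2, ← hl T w v hw hv hT.2.1 hT.1 hT.2.2]
        abel)
      (by
        intro x y z _ _ _ h
        obtain ⟨hx, hy, hz, hK'⟩ := triple_mem_link.1 h
        obtain ⟨T, hT⟩ := hK.exists_facet hK'
        simp only [Finset.insert_subset_iff] at hT
        obtain ⟨hxT, hyT, hzT, hT⟩ := hT
        rw [← hl T x y hx hy hxT hyT hT, ← hl T y z hy hz hyT hzT hT, ← hl T z x hz hx hzT hxT hT]
        abel)
    -- The corrected potentials `G v - g v` agree where their stars meet; evaluate at `T` the one for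
    -- any vertex `v T` of `T` outside `σ`.
    have hv : ∀ T : Facet K n, ∃ v ∈ T.1, v ∉ σ := fun T => T.exists_notMem (by omega)
    choose v hvT hv using hv
    have key : ∀ T : Facet K n, σ ⊆ T.1 → ∀ w ∈ T.1, w ∉ σ →
        G (v T) T - g (v T) = G w T - g w := by
      intro T hT w hwT hw
      rcases eq_or_ne (v T) w with h | h
      · rw [h]
      · have h1 := hg _ _ h (pair_mem_link.2 ⟨hv T, hw,
          T.insert_mem (Finset.insert_subset hwT hT) (hvT T)⟩)
        rw [← hl T _ _ (hv T) hw (hvT T) hwT hT] at h1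
        rw [sub_eq_sub_iff_add_eq_add] at h1 ⊢
        rw [h1, add_comm]
    refine ⟨fun T => G (v T) T - g (v T), fun T T' hadj hT hT' => ?_⟩
    obtain ⟨w, hwT, hw⟩ : ∃ w ∈ T.1 ∩ T'.1, w ∉ σ := by
      by_contra! h
      have := Finset.card_le_card (show T.1 ∩ T'.1 ⊆ σ from h)
      have := hadj.2
      omega
    rw [Finset.mem_inter] at hwT
    simp only
    rw [key T hT w hwT.1 hw, key T' hT' w hwT.2 hw, hG w ⟨hw, T.insert_mem hT hwT.1⟩ T T' hadj
      (Finset.insert_subset hwT.1 hT) (Finset.insert_subset hwT.2 hT')]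
    abel

end Manifold

/-! ### Framed 1-cochains -/

section Framed

variable {K : AbstractSimplicialComplex V} {n : ℕ} {B : Type*} [AddCommGroup B]

/-- The sum of a framed 1-cochain `g` over a multiset of framed oriented edges. -/
def edgeSum (g : Facet K n → V → V → B) : Multiset (FramedEdge K n) →+ B :=
  Multiset.sumAddMonoidHom.comp (Multiset.mapAddMonoidHom fun e => g e.2.2 e.1 e.2.1)

theorem edgeSum_coe (g : Facet K n → V → V → B) (E : List (FramedEdge K n)) :
    edgeSum g (E : Multiset (FramedEdge K n)) = (E.map fun e => g e.2.2 e.1 e.2.1).sum := by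
  simp [edgeSum]

theorem edgeSum_nil (g : Facet K n → V → V → B) :
    edgeSum g (([] : List (FramedEdge K n)) : Multiset (FramedEdge K n)) = 0 := by
  simp

theorem edgeSum_cons (g : Facet K n → V → V → B) (e : FramedEdge K n)
    (E : List (FramedEdge K n)) :
    edgeSum g ((e :: E : List (FramedEdge K n)) : Multiset (FramedEdge K n)) =
      g e.2.2 e.1 e.2.1 + edgeSum g (E : Multiset (FramedEdge K n)) := by
  simp [edgeSum_coe]

theorem edgeSum_append (g : Facet K n → V → V → B) (E E' : List (FramedEdge K n)) :
    edgeSum g ((E ++ E' : List (FramedEdge K n)) : Multiset (FramedEdge K n)) =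
      edgeSum g (E : Multiset (FramedEdge K n)) + edgeSum g (E' : Multiset (FramedEdge K n)) := by
  simp [edgeSum_coe]

theorem map_edgeSum {C : Type*} [AddCommGroup C] (φ : B →+ C) (g : Facet K n → V → V → B)
    (E : Multiset (FramedEdge K n)) :
    φ (edgeSum g E) = edgeSum (fun T i j => φ (g T i j)) E := by
  simp [edgeSum, Multiset.map_map, map_multiset_sum]

/-- The sum of a framed 1-cochain along a framed path. -/
def pathSum (g : Facet K n → V → V → B) {i j : V} (p : FramedPath K n i j) : B :=
  edgeSum g (p.edges : Multiset (FramedEdge K n))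

theorem pathSum_nil (g : Facet K n → V → V → B) (i : V) :
    pathSum g (FramedPath.nil i : FramedPath K n i i) = 0 :=
  edgeSum_nil g

theorem pathSum_cons (g : Facet K n → V → V → B) {i j l : V} (T : Facet K n) (h : IsEdge T i j)
    (p : FramedPath K n j l) : pathSum g (.cons T h p) = g T i j + pathSum g p :=
  edgeSum_cons g _ _

theorem pathSum_comp (g : Facet K n → V → V → B) {i j l : V} (p : FramedPath K n i j)
    (q : FramedPath K n j l) : pathSum g (p.comp q) = pathSum g p + pathSum g q := by
  rw [pathSum, FramedPath.edges_comp, edgeSum_append]; rfl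

theorem map_pathSum {C : Type*} [AddCommGroup C] (φ : B →+ C) (g : Facet K n → V → V → B)
    {i j : V} (p : FramedPath K n i j) :
    φ (pathSum g p) = pathSum (fun T i j => φ (g T i j)) p :=
  map_edgeSum φ g _

/-- The sum of a framed 1-cochain over the boundary edges of a framed triangle. -/
def triangleSum (g : Facet K n → V → V → B) (T : Facet K n) (i j l : V) : B :=
  g T i j + g T j l + g T l i

theorem edgeSum_triangles (g : Facet K n → V → V → B) (Δs : List (FramedTriangle K n)) :
    edgeSum g (Δs.flatMap FramedTriangle.edges : List (FramedEdge K n)) =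
      (Δs.map fun Δ => triangleSum g Δ.frame Δ.a Δ.b Δ.c).sum := by
  induction Δs with
  | nil => simp
  | cons Δ Δs ih =>
    rw [List.flatMap_cons, edgeSum_append, ih, List.map_cons, List.sum_cons]
    simp [FramedTriangle.edges, edgeSum_coe, triangleSum, add_assoc]

theorem pathSum_reverse {g : Facet K n → V → V → B}
    (hg : ∀ T i j, IsEdge T i j → g T i j + g T j i = 0) {i j : V} (p : FramedPath K n i j) :
    pathSum g p.reverse = - pathSum g p := by
  induction p with
  | nil => simp [FramedPath.reverse, pathSum_nil]
  | cons T h p ih =>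
    rw [FramedPath.reverse, pathSum_comp, ih, pathSum_cons, pathSum_cons, pathSum_nil,
      eq_neg_of_add_eq_zero_right (hg _ _ _ h)]
    abel

theorem pathChain_eq {i j : V} (p : FramedPath K n i j) :
    pathChain p = pathSum (fun _ i j => Finsupp.single ![i, j] 1) p :=
  (edgeSum_coe (fun _ i j => Finsupp.single ![i, j] 1) p.edges).symm

theorem cochain_pathChain (e : V → V → B) {i j : V} (p : FramedPath K n i j) :
    cochain (fun w : Fin 2 → V => e (w 0) (w 1)) (pathChain p) = pathSum (fun _ => e) p := by
  rw [pathChain_eq, map_pathSum]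
  simp

theorem boundary_pathChain {i j : V} (p : FramedPath K n i j) :
    boundary V 1 (pathChain p) = point j - point i := by
  rw [pathChain_eq]
  induction p with
  | nil => simp [pathSum_nil]
  | cons T h p ih =>
    rw [pathSum_cons, map_add, ih, boundary_single_two]
    simp

variable [DecidableEq V]

/-- The additive form of `pairProd`. -/
def pairSum (r : Facet K n → Facet K n → V → V → B) (pairs : List (FramedPair K n)) : B :=
  (pairs.map fun P => walkSum (fun T T' => r T T' P.i P.j) P.path).sum

/-- `r` is the variation of the framed 1-cochain `g` under a change of the framing. -/
def IsVariation (r : Facet K n → Facet K n → V → V → B) (g : Facet K n → V → V → B) : Prop :=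
  ∀ T T', (dualGraph K n).Adj T T' → ∀ i j, i ≠ j → {i, j} ⊆ T.1 ∩ T'.1 →
    r T T' i j = g T i j - g T' i j

variable {g : Facet K n → V → V → B} {r : Facet K n → Facet K n → V → V → B}

theorem IsVariation.walkSum_eq (hgr : IsVariation r g) {i j : V} (hij : i ≠ j)
    {T T' : Facet K n} (w : (dualGraph K n).Walk T T') (hw : InStar {i, j} w) :
    walkSum (fun T T' => r T T' i j) w = g T i j - g T' i j :=
  walkSum_eq_sub (S := {T : Facet K n | ({i, j} : Finset V) ⊆ T.1}) (fun T T' => r T T' i j)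
    (g := fun T => g T i j)
    (fun T T' h hT hT' => hgr T T' h i j hij
      (Finset.subset_inter hT hT')) w hw

theorem IsVariation.pairSum_eq (hgr : IsVariation r g)
    (hg : ∀ T i j, IsEdge T i j → g T i j + g T j i = 0) (pairs : List (FramedPair K n)) :
    pairSum r pairs =
      - edgeSum g (pairs.flatMap FramedPair.edges : List (FramedEdge K n)) := by
  induction pairs with
  | nil => simp [pairSum]
  | cons P pairs ih =>
    have h : IsEdge P.frame P.i P.j := by
      have := P.inStar _ P.path.start_mem_support
      simp only [Finset.insert_subset_iff, Finset.singleton_subset_iff] at this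
      exact ⟨P.ne, this⟩
    rw [List.flatMap_cons, edgeSum_append, neg_add, ← ih, pairSum, List.map_cons, List.sum_cons,
      hgr.walkSum_eq P.ne P.path P.inStar]
    simp only [FramedPair.edges, edgeSum_cons, edgeSum_nil]
    rw [eq_neg_of_add_eq_zero_left (hg _ _ _ h), pairSum]
    abel

theorem IsVariation.pairSum_cycle (hgr : IsVariation r g)
    (hg : ∀ T i j, IsEdge T i j → g T i j + g T j i = 0) (z : FramedCycle K n) :
    pairSum r z.pairs =
      - (z.triangles.map fun Δ => triangleSum g Δ.frame Δ.a Δ.b Δ.c).sum := by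
  rw [hgr.pairSum_eq hg, ← edgeSum_triangles]
  exact congrArg (fun E => - edgeSum g E) z.closed.symm

theorem IsVariation.pairSum_torsion (hgr : IsVariation r g)
    (hg : ∀ T i j, IsEdge T i j → g T i j + g T j i = 0) {x : V} {a : FramedLoop K n x} {m : ℕ}
    (u : FramedTorsionChain a m) :
    pairSum r u.pairs = m • pathSum g a -
      (u.triangles.map fun Δ => triangleSum g Δ.frame Δ.a Δ.b Δ.c).sum := by
  have h := congrArg (edgeSum g) u.bounds
  rw [map_add, map_nsmul, edgeSum_triangles] at h
  have h' : edgeSum g (FramedPath.edges (FramedPath.reverse a) : Multiset (FramedEdge K n)) =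
      - pathSum g a := pathSum_reverse hg a
  rw [h'] at h
  rw [hgr.pairSum_eq hg]
  refine (congrArg Neg.neg h.symm).trans ?_
  rw [smul_neg]
  abel

/-! ### Chains underlying framed objects -/

theorem IsEdge.pair_subset {T : Facet K n} {i j : V} (h : IsEdge T i j) : {i, j} ⊆ T.1 :=
  Finset.insert_subset h.2.1 (Finset.singleton_subset_iff.2 h.2.2)

theorem IsEdge.pair_mem {T : Facet K n} {i j : V} (h : IsEdge T i j) : {i, j} ∈ K :=
  mem_of_subset T.2.1 h.pair_subset (Finset.insert_nonempty _ _)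

theorem IsEdge.single_mem_chains {T : Facet K n} {i j : V} (h : IsEdge T i j) :
    Finsupp.single ![i, j] 1 ∈ chains K.toPreAbstractSimplicialComplex 2 :=
  pair_mem_chains h.1 h.pair_mem

theorem pathChain_mem_chains {i j : V} (p : FramedPath K n i j) :
    pathChain p ∈ chains K.toPreAbstractSimplicialComplex 2 := by
  rw [pathChain_eq]
  induction p with
  | nil => rw [pathSum_nil]; exact zero_mem _
  | cons T h p ih => rw [pathSum_cons]; exact add_mem h.single_mem_chains ih

theorem mem_cycles_of_boundary_eq_zero {L : PreAbstractSimplicialComplex V} {q : ℕ}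
    {x : (Fin (q + 1) → V) →₀ ℤ} (hx : x ∈ chains L (q + 1))
    (h : boundary V q x ∈ orientationRelations L q) : x ∈ cycles L (q + 1) :=
  ⟨hx, h⟩

theorem pathChain_mem_cycles {x : V} (p : FramedLoop K n x) :
    pathChain p ∈ cycles K.toPreAbstractSimplicialComplex 2 :=
  mem_cycles_of_boundary_eq_zero (pathChain_mem_chains p) (by
    rw [boundary_pathChain, sub_self]; exact zero_mem _)

theorem swap_mem_orientationRelations {L : PreAbstractSimplicialComplex V} {i j : V}
    (hij : i ≠ j) (h : {i, j} ∈ L) :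
    Finsupp.single ![i, j] 1 + Finsupp.single ![j, i] 1 ∈ orientationRelations L 2 := by
  refine AddSubgroup.subset_closure ⟨![j, i], mem_orderedSimplices_two.2
    ⟨hij.symm, by simpa [Finset.pair_comm] using h⟩, Equiv.swap 0 1, ?_⟩
  have : ![j, i] ∘ (Equiv.swap 0 1 : Equiv.Perm (Fin 2)) = ![i, j] := by
    funext x; fin_cases x <;> simp
  rw [this]
  simp [← Finsupp.single_neg, sub_eq_add_neg]

theorem FramedTriangle.mem_orderedSimplices (Δ : FramedTriangle K n) :
    ![Δ.a, Δ.b, Δ.c] ∈ orderedSimplices K.toPreAbstractSimplicialComplex 3 :=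
  mem_orderedSimplices_three.2 ⟨Δ.ab.1, Δ.bc.1, Δ.ca.1, mem_of_subset Δ.frame.2.1
    (Finset.insert_subset Δ.ab.2.1 Δ.bc.pair_subset) (Finset.insert_nonempty _ _)⟩

theorem triangleChain_mem_chains (Δs : List (FramedTriangle K n)) :
    triangleChain Δs ∈ chains K.toPreAbstractSimplicialComplex 3 := by
  refine AddSubgroup.list_sum_mem _ fun x hx => ?_
  obtain ⟨Δ, -, rfl⟩ := List.mem_map.1 hx
  exact single_mem_chains Δ.mem_orderedSimplices

/-- The boundary of a framed 2-chain `u` with `∂u = m a`, modulo orientation relations. -/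
theorem mk_boundary_torsion {x : V} {a : FramedLoop K n x} {m : ℕ}
    (u : FramedTorsionChain a m) :
    QuotientAddGroup.mk' (orientationRelations K.toPreAbstractSimplicialComplex 2)
        (boundary V 2 (triangleChain u.triangles)) =
      m • QuotientAddGroup.mk' (orientationRelations K.toPreAbstractSimplicialComplex 2)
        (pathChain a) := by
  set q := QuotientAddGroup.mk' (orientationRelations K.toPreAbstractSimplicialComplex 2) with hq
  let g : Facet K n → V → V → _ := fun _ i j => q (Finsupp.single ![i, j] 1)
  have hg : ∀ (T : Facet K n) i j, IsEdge T i j → g T i j + g T j i = 0 := by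
    intro T i j h
    rw [← map_add, hq, QuotientAddGroup.mk'_apply, QuotientAddGroup.eq_zero_iff]
    exact swap_mem_orientationRelations h.1 h.pair_mem
  -- The framings play no role for `g`, so its variation is zero.
  have h0 : IsVariation (fun _ _ _ _ => 0) g := fun T T' _ i j _ _ => (sub_self _).symm
  have h := h0.pairSum_torsion hg u
  rw [show pairSum (fun _ _ _ _ => 0) u.pairs = (0 : _ ⧸ _) by simp [pairSum, walkSum],
    eq_comm, sub_eq_zero] at h
  rw [pathChain_eq, map_pathSum, h, triangleChain, map_list_sum, map_list_sum, List.map_map,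
    List.map_map]
  congr 1
  refine List.map_congr_left fun Δ _ => ?_
  simp only [Function.comp, boundary_single_three, map_add, map_sub, triangleSum, g]
  have h := hg Δ.frame _ _ Δ.ca
  simp only [g, Matrix.cons_val] at h ⊢
  rw [eq_neg_of_add_eq_zero_left h]
  abel

end Framed

/-! ### Cochains with prescribed values on cycles -/

theorem cochain_comp {X B C : Type*} [AddCommGroup B] [AddCommGroup C] (φ : B →+ C) (f : X → B)
    (x : X →₀ ℤ) : φ (cochain f x) = cochain (fun t => φ (f t)) x := by
  refine DFunLike.congr_fun (?_ : φ.comp (cochain f) = cochain fun t => φ (f t)) x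
  refine Finsupp.addHom_ext fun t c => ?_
  simp

theorem cochain_eq_sum {X B : Type*} [AddCommGroup B] (f : X → B) (x : X →₀ ℤ) :
    cochain f x = x.sum fun t c => c • f t := rfl

section Homology

variable [DecidableEq V] {L : PreAbstractSimplicialComplex V} {B : Type*} [AddCommGroup B]

/-- A homomorphism `Ψ` that factors through a surjection `P` to the 1-cycles extends to a
1-cochain: the assignment `[v, w] ↦ c v + [v, w] - c w`, where the chain `c v` joins `v₀` to `v`,
is a retraction of the 1-chains to the 1-cycles. -/
theorem exists_cochain_of_ker_le {F : Type*} [AddCommGroup F]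
    (P : F →+ ((Fin 2 → V) →₀ ℤ)) (Ψ : F →+ B) (hker : ∀ y, P y = 0 → Ψ y = 0)
    (hsurj : ∀ x ∈ cycles L 2, ∃ y, P y = x) {v₀ : V}
    (hc : ∀ v, {v} ∈ L → ∃ c ∈ chains L 2, boundary V 1 c = point v - point v₀) :
    ∃ e : V → V → B, ∀ y, P y ∈ cycles L 2 →
      cochain (fun w : Fin 2 → V => e (w 0) (w 1)) (P y) = Ψ y := by
  choose! c hcL hcb using hc
  have hcyc : ∀ v w, v ≠ w ∧ {v, w} ∈ L → ∃ y, P y = c v + Finsupp.single ![v, w] 1 - c w := by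
    rintro v w ⟨hne, h⟩
    have hv : {v} ∈ L := (L.isRelLowerSet_faces h).2 (by simp) (by simp)
    have hw : {w} ∈ L := (L.isRelLowerSet_faces h).2 (by simp) (by simp)
    refine hsurj _ (mem_cycles_of_boundary_eq_zero ((chains L 2).sub_mem
      ((chains L 2).add_mem (hcL v hv) (pair_mem_chains hne h)) (hcL w hw)) ?_)
    simp only [map_sub, map_add, hcb v hv, hcb w hw, boundary_single_two]
    simp
  choose! y hy using hcyc
  let Y : ((Fin 2 → V) →₀ ℤ) →+ F := cochain fun w => y (w 0) (w 1)
  let C : ((Fin 1 → V) →₀ ℤ) →+ ((Fin 2 → V) →₀ ℤ) := cochain fun w => c (w 0)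
  have hPY : chains L 2 ≤ (P.comp Y).eqLocus (AddMonoidHom.id _ - C.comp (boundary V 1)) := by
    rw [chains, AddSubgroup.closure_le]
    rintro _ ⟨w, hw, rfl⟩
    have h : w = ![w 0, w 1] := by funext i; fin_cases i <;> rfl
    change P (Y _) = Finsupp.single w 1 - C (boundary V 1 _)
    simp only [boundary_single_two, map_sub, Y, C, cochain_single, one_smul,
      hy _ _ (mem_orderedSimplices_two.1 hw), ← h]
    abel
  refine ⟨fun v w => Ψ (y v w), fun x hx => ?_⟩
  have hb : boundary V 1 (P x) = 0 := by
    have := hx.2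
    rwa [orientationRelations_one] at this
  have h1 : P (Y (P x)) = P x := by
    have : P (Y (P x)) = P x - C (boundary V 1 (P x)) := hPY hx.1
    rwa [hb, map_zero, sub_zero] at this
  have h2 := hker (Y (P x) - x) (by rw [map_sub, h1, sub_self])
  rw [map_sub, sub_eq_zero] at h2
  rw [← h2, cochain_comp]

end Homology

section Manifold

variable [DecidableEq V] {K : AbstractSimplicialComplex V} {n : ℕ} {B : Type*} [AddCommGroup B]

theorem exists_chain_of_connected (hconn : (edgeGraph K).Connected) (v₀ v : V) :
    ∃ c ∈ chains K.toPreAbstractSimplicialComplex 2, boundary V 1 c = point v - point v₀ := by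
  obtain ⟨w⟩ := hconn.preconnected v₀ v
  induction w with
  | nil => exact ⟨0, zero_mem _, by simp⟩
  | @cons a b _ h _ ih =>
    obtain ⟨c, hc, hb⟩ := ih
    refine ⟨Finsupp.single ![a, b] 1 + c, add_mem (pair_mem_chains h.1 h.2) hc, ?_⟩
    rw [map_add, hb, boundary_single_two]
    simp

/-! ### The triangle cochain of a framed 1-cochain -/

/-- The sums of `g` over the boundaries of triangles do not depend on the framing. -/
def TriangleInvariant (g : Facet K n → V → V → B) : Prop :=
  ∀ (T T' : Facet K n) (i j l : V), i ≠ j → j ≠ l → l ≠ i → {i, j, l} ⊆ T.1 → {i, j, l} ⊆ T'.1 →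
    triangleSum g T i j l = triangleSum g T' i j l

open Classical in
/-- The sum of `g` over the boundary of the triangle `w`, framed by any `n`-simplex containing it;
zero if there is none. -/
noncomputable def triangleCochain (g : Facet K n → V → V → B) : ((Fin 3 → V) →₀ ℤ) →+ B :=
  cochain fun w => if h : ∃ T : Facet K n, ({w 0, w 1, w 2} : Finset V) ⊆ T.1 then
    triangleSum g h.choose (w 0) (w 1) (w 2) else 0

variable {g : Facet K n → V → V → B}

theorem triangleCochain_single (hinv : TriangleInvariant g) {T : Facet K n} {w : Fin 3 → V}
    (h1 : w 0 ≠ w 1) (h2 : w 1 ≠ w 2) (h3 : w 2 ≠ w 0) (hT : {w 0, w 1, w 2} ⊆ T.1) (c : ℤ) :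
    triangleCochain g (Finsupp.single w c) = c • triangleSum g T (w 0) (w 1) (w 2) := by
  have h : ∃ T : Facet K n, ({w 0, w 1, w 2} : Finset V) ⊆ T.1 := ⟨T, hT⟩
  rw [triangleCochain, cochain_single, dif_pos h, hinv _ T _ _ _ h1 h2 h3 h.choose_spec hT]

theorem triangleCochain_triangleChain (hinv : TriangleInvariant g)
    (Δs : List (FramedTriangle K n)) : triangleCochain g (triangleChain Δs) =
      (Δs.map fun Δ => triangleSum g Δ.frame Δ.a Δ.b Δ.c).sum := by
  rw [triangleChain, map_list_sum, List.map_map]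
  congr 1
  refine List.map_congr_left fun Δ _ => ?_
  rw [Function.comp, triangleCochain_single hinv (T := Δ.frame) Δ.ab.1 Δ.bc.1 Δ.ca.1
    (Finset.insert_subset Δ.ab.2.1 Δ.bc.pair_subset), one_smul]
  rfl

theorem perm_fin_three (π : Equiv.Perm (Fin 3)) : π = 1 ∨ π = Equiv.swap 0 1 ∨
    π = Equiv.swap 1 2 ∨ π = Equiv.swap 0 2 ∨ π = Equiv.swap 0 1 * Equiv.swap 1 2 ∨
    π = Equiv.swap 1 2 * Equiv.swap 0 1 := by
  revert π; decide

/-- The triangle cochain is closed, because a tetrahedron is framed by one `n`-simplex. -/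
theorem boundaries_le_ker_triangleCochain (hK : IsTriangulatedManifold K n)
    (hg : ∀ T i j, IsEdge T i j → g T i j + g T j i = 0) (hinv : TriangleInvariant g) :
    boundaries K.toPreAbstractSimplicialComplex 3 ≤ (triangleCochain g).ker := by
  refine boundaries_le_ker _ (fun w hw => ?_) (fun w hw π => ?_)
  · obtain ⟨T, hT⟩ := hK.exists_facet (hw.2.resolve_left (by decide))
    have hmem : ∀ r, w r ∈ T.1 := fun r => hT (Finset.mem_image_of_mem _ (Finset.mem_univ r))
    have hne : ∀ r s, r ≠ s → w r ≠ w s := fun r s h => hw.1.ne h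
    have ht : ∀ r s t : Fin 4, r ≠ s → s ≠ t → t ≠ r →
        triangleCochain g (Finsupp.single ![w r, w s, w t] 1) =
          triangleSum g T (w r) (w s) (w t) := by
      intro r s t h1 h2 h3
      rw [triangleCochain_single hinv (T := T) (hne _ _ h1) (hne _ _ h2) (hne _ _ h3), one_smul]
      · rfl
      · intro x hx
        simp only [Finset.mem_insert, Finset.mem_singleton] at hx
        rcases hx with rfl | rfl | rfl <;> exact hmem _
    have hanti : ∀ r s, r ≠ s → g T (w r) (w s) = - g T (w s) (w r) := fun r s h =>
      eq_neg_of_add_eq_zero_left (hg T _ _ ⟨hne _ _ h, hmem _, hmem _⟩)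
    rw [boundary_single_four]
    simp only [map_add, map_sub]
    rw [ht 1 2 3 (by decide) (by decide) (by decide), ht 0 2 3 (by decide) (by decide) (by decide),
      ht 0 1 3 (by decide) (by decide) (by decide), ht 0 1 2 (by decide) (by decide) (by decide)]
    simp only [triangleSum]
    rw [hanti 3 1 (by decide), hanti 2 0 (by decide)]
    abel
  · obtain ⟨h1, h2, h3, h⟩ := mem_orderedSimplices_three.1 hw
    obtain ⟨T, hT⟩ := hK.exists_facet h
    have hmem : ∀ r, w r ∈ T.1 := by
      intro r
      apply hT
      fin_cases r <;> simp
    have hne : ∀ r s, r ≠ s → w r ≠ w s := fun r s h => hw.1.ne h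
    have ht : ∀ (π : Equiv.Perm (Fin 3)) (c : ℤ), triangleCochain g (Finsupp.single (w ∘ π) c) =
        c • triangleSum g T (w (π 0)) (w (π 1)) (w (π 2)) := by
      intro π c
      have hi := hw.1.comp π.injective
      refine triangleCochain_single hinv (hi.ne (by decide)) (hi.ne (by decide))
        (hi.ne (by decide)) ?_ c
      intro x hx
      simp only [Finset.mem_insert, Finset.mem_singleton] at hx
      rcases hx with rfl | rfl | rfl <;> exact hmem _
    have hanti : ∀ r s, r ≠ s → g T (w r) (w s) = - g T (w s) (w r) := fun r s h =>
      eq_neg_of_add_eq_zero_left (hg T _ _ ⟨hne _ _ h, hmem _, hmem _⟩)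
    rw [ht π, one_smul]
    rw [triangleCochain_single hinv h1 h2 h3 hT]
    have e10 := hanti 1 0 (by decide)
    have e20 := hanti 2 0 (by decide)
    have e21 := hanti 2 1 (by decide)
    simp only [triangleSum]
    rcases perm_fin_three π with rfl | rfl | rfl | rfl | rfl | rfl
    · simp
    · simp [Equiv.swap_apply_def, e10, e20, e21]; abel
    · simp [Equiv.swap_apply_def, e10, e20, e21]; abel
    · simp [Equiv.swap_apply_def, e10, e20, e21]; abel
    · simp [Equiv.swap_apply_def, e20]; abel
    · simp [Equiv.swap_apply_def, e20]; abel

theorem exists_eq_cochain_of_dvd {X : Type*} (m : X → ℕ) (x : X →₀ ℤ)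
    (h : ∀ s, (m s : ℤ) ∣ x s) :
    ∃ y : X →₀ ℤ, x = cochain (fun s => Finsupp.single s (m s : ℤ)) y := by
  choose d hd using h
  refine ⟨∑ s ∈ x.support, Finsupp.single s (d s), ?_⟩
  rw [map_sum]
  conv_lhs => rw [← x.sum_single, Finsupp.sum]
  refine Finset.sum_congr rfl fun s _ => ?_
  rw [cochain_single, Finsupp.smul_single, smul_eq_mul, hd s, mul_comm]

/-- The correction of the framed 1-cochain `g` by a 1-cochain `e` of the complex: it becomes
closed on the framed triangles and takes prescribed sums on the basic closed paths. -/
theorem exists_correction (hK : IsTriangulatedManifold K n) (hconn : (edgeGraph K).Connected)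
    {G A Z : Type*} (H : HomologyBasis K n G A Z)
    (hg : ∀ T i j, IsEdge T i j → g T i j + g T j i = 0) (hinv : TriangleInvariant g)
    {r : Facet K n → Facet K n → V → V → B} (hgr : IsVariation r g) (c : G → B) (α : A → B)
    (hz : ∀ s, pairSum r (H.z s).pairs = 0)
    (hu : ∀ s, pairSum r (H.u s).pairs = H.m s • α s) :
    ∃ e : V → V → B, (∀ (T : Facet K n) i j, IsEdge T i j → e i j + e j i = 0) ∧
      (∀ T i j l, IsEdge T i j → IsEdge T j l → IsEdge T l i →
        triangleSum g T i j l + (e i j + e j l + e l i) = 0) ∧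
      (∀ s, pathSum g (H.γ s) + pathSum (fun _ => e) (H.γ s) = c s) ∧
      (∀ s, pathSum g (H.a s) + pathSum (fun _ => e) (H.a s) = α s) := by
  classical
  let L := K.toPreAbstractSimplicialComplex
  let t := triangleCochain g
  have ht : boundaries L 3 ≤ t.ker := boundaries_le_ker_triangleCochain hK hg hinv
  have htz : cycles L 3 ≤ t.ker := by
    refine H.span_two.trans (sup_le ?_ ht)
    rw [AddSubgroup.closure_le]
    rintro _ ⟨s, rfl⟩
    have := hgr.pairSum_cycle hg (H.z s)
    rw [hz, ← triangleCochain_triangleChain hinv, eq_comm, neg_eq_zero] at this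
    exact this
  have htu : ∀ s, t (triangleChain (H.u s).triangles) =
      H.m s • (pathSum g (H.a s) - α s) := by
    intro s
    have := hgr.pairSum_torsion hg (H.u s)
    rw [hu, ← triangleCochain_triangleChain hinv, eq_sub_iff_add_eq, ← eq_sub_iff_add_eq'] at this
    rw [smul_sub]
    exact this
  -- `P` maps combinations of generators to 1-cycles, and `Ψ` is the value that `e` must take there.
  let P : (G →₀ ℤ) × (A →₀ ℤ) × chains L 3 × orientationRelations L 2 →+ ((Fin 2 → V) →₀ ℤ) :=
    (cochain fun s => pathChain (H.γ s)).coprod ((cochain fun s => pathChain (H.a s)).coprod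
      (((boundary V 2).comp (chains L 3).subtype).coprod (orientationRelations L 2).subtype))
  let Ψ : (G →₀ ℤ) × (A →₀ ℤ) × chains L 3 × orientationRelations L 2 →+ B :=
    (cochain fun s => c s - pathSum g (H.γ s)).coprod
      ((cochain fun s => α s - pathSum g (H.a s)).coprod ((-(t.comp (chains L 3).subtype)).coprod 0))
  have hP : ∀ f f' x o, P (f, f', x, o) = cochain (fun s => pathChain (H.γ s)) f +
      (cochain (fun s => pathChain (H.a s)) f' + (boundary V 2 x + o)) := fun _ _ _ _ => rfl
  have hΨ : ∀ f f' x o, Ψ (f, f', x, o) = cochain (fun s => c s - pathSum g (H.γ s)) f +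
      (cochain (fun s => α s - pathSum g (H.a s)) f' + (- t x + 0)) := fun _ _ _ _ => rfl
  have hker : ∀ y, P y = 0 → Ψ y = 0 := by
    rintro ⟨f, f', ⟨x, hx⟩, ⟨o, ho⟩⟩ h
    rw [hP] at h
    rw [hΨ]
    have hmem : cochain (fun s => pathChain (H.γ s)) f + cochain (fun s => pathChain (H.a s)) f' ∈
        boundaries L 2 := by
      rw [← add_assoc] at h
      rw [eq_neg_of_add_eq_zero_left h]
      exact neg_mem (AddSubgroup.add_mem_sup ⟨x, hx, rfl⟩ ho)
    obtain ⟨rfl, hdvd⟩ := H.indep f f' hmem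
    obtain ⟨d, rfl⟩ := exists_eq_cochain_of_dvd H.m f' hdvd
    rw [map_zero, zero_add] at h ⊢
    rw [cochain_comp] at h ⊢
    simp only [cochain_single] at h ⊢
    -- Adding the chains `u s` completes `x` to a cycle.
    have hcyc : x + cochain (fun s => triangleChain (H.u s).triangles) d ∈ cycles L 3 := by
      refine mem_cycles_of_boundary_eq_zero (add_mem hx ?_) ?_
      · rw [cochain_eq_sum]
        exact sum_mem fun s _ => zsmul_mem (triangleChain_mem_chains _) _
      · rw [← QuotientAddGroup.eq_zero_iff, ← QuotientAddGroup.mk'_apply, map_add, map_add,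
          cochain_comp, cochain_comp]
        have h' := congrArg (QuotientAddGroup.mk' (orientationRelations L 2)) h
        have ho' : QuotientAddGroup.mk' (orientationRelations L 2) o = 0 :=
          (QuotientAddGroup.eq_zero_iff o).2 ho
        simp only [map_add, ho', add_zero, cochain_comp, map_zero, map_zsmul] at h'
        simp only [L, mk_boundary_torsion]
        rw [add_comm]
        simpa only [natCast_zsmul] using h'
    have h0 : t x + t (cochain (fun s => triangleChain (H.u s).triangles) d) = 0 := by
      rw [← map_add]; exact htz hcyc
    rw [cochain_comp] at h0
    rw [add_zero, eq_neg_of_add_eq_zero_left h0, neg_neg, cochain_eq_sum, cochain_eq_sum,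
      ← Finsupp.sum_add]
    refine Finset.sum_eq_zero fun s _ => ?_
    simp only [htu, natCast_zsmul]
    rw [← smul_add, ← smul_add, sub_add_sub_cancel, sub_self, smul_zero, smul_zero]
  have hsurj : ∀ x ∈ cycles L 2, ∃ y, P y = x := by
    intro x hx
    obtain ⟨f, f', hb⟩ := H.span_one x hx
    obtain ⟨_, ⟨y, hy, rfl⟩, o, ho, h⟩ := AddSubgroup.mem_sup.1 hb
    refine ⟨(f, f', ⟨y, hy⟩, ⟨o, ho⟩), ?_⟩
    rw [hP]
    simp only [h, cochain_eq_sum]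
    abel
  obtain ⟨v₀⟩ := hconn.nonempty
  obtain ⟨e, he⟩ := exists_cochain_of_ker_le (L := L) P Ψ hker hsurj
    (v₀ := v₀) fun v _ => exists_chain_of_connected hconn v₀ v
  have hanti : ∀ (T : Facet K n) i j, IsEdge T i j → e i j + e j i = 0 := by
    intro T i j h
    have hP' := hP 0 0 0 ⟨_, swap_mem_orientationRelations (L := L) h.1 h.pair_mem⟩
    simp only [map_zero, zero_add, ZeroMemClass.coe_zero] at hP'
    have := he _ (hP' ▸ mem_cycles_of_boundary_eq_zero
      (add_mem h.single_mem_chains h.symm.single_mem_chains)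
      (by simp only [map_add, boundary_single_two]; simp))
    rw [hP', hΨ] at this
    simpa using this
  refine ⟨e, hanti, ?_, ?_, ?_⟩
  · intro T i j l hij hjl hli
    let Δ : FramedTriangle K n := ⟨i, j, l, T, hij, hjl, hli⟩
    have hP' := hP 0 0 ⟨_, single_mem_chains Δ.mem_orderedSimplices⟩ 0
    simp only [map_zero, zero_add, ZeroMemClass.coe_zero, add_zero, boundary_single_three] at hP'
    have := he _ (hP' ▸ mem_cycles_of_boundary_eq_zero
      (add_mem (sub_mem hjl.single_mem_chains hli.symm.single_mem_chains) hij.single_mem_chains)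
      (by simp only [map_add, map_sub, boundary_single_two]; simp))
    rw [hP', hΨ] at this
    have h1 : t (Finsupp.single ![i, j, l] 1) = triangleSum g T i j l := by
      have := triangleCochain_triangleChain hinv [Δ]
      simpa [triangleChain] using this
    simp only [map_zero, zero_add, add_zero, map_add, map_sub, cochain_single, one_smul] at this
    simp only [Matrix.cons_val] at this
    rw [show t (Finsupp.single ![Δ.a, Δ.b, Δ.c] 1) = triangleSum g T i j l from h1,
      eq_neg_iff_add_eq_zero] at this
    rw [← this, eq_neg_of_add_eq_zero_left (hanti T l i hli)]
    simp only [Δ]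
    abel
  · intro s
    have hP' := hP (Finsupp.single s 1) 0 0 0
    simp only [map_zero, add_zero, ZeroMemClass.coe_zero, cochain_single, one_smul] at hP'
    have := he _ (hP' ▸ pathChain_mem_cycles (H.γ s))
    rw [hP', hΨ, cochain_pathChain] at this
    rw [this]
    simp
  · intro s
    have hP' := hP 0 (Finsupp.single s 1) 0 0
    simp only [map_zero, add_zero, zero_add, ZeroMemClass.coe_zero, cochain_single,
      one_smul] at hP'
    have := he _ (hP' ▸ pathChain_mem_cycles (H.a s))
    rw [hP', hΨ, cochain_pathChain] at this
    rw [this]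
    simp

end Manifold

/-! ### Connections as framed 1-cochains -/

section Connection

variable {K : AbstractSimplicialComplex V} {n : ℕ} {k : Type v} [Field k]

/-- The framed 1-cochain with values `-μ T i j` in the additive form of `kˣ`, whose sums along
framed paths are the framed abelian holonomies. -/
def Connection.toCochain (μ : Connection K n k) : Facet K n → V → V → Additive kˣ :=
  fun T i j => Additive.ofMul (- μ.coeff T i j)

theorem Connection.toCochain_anti (μ : Connection K n k) (T : Facet K n) (i j : V)
    (h : IsEdge T i j) : μ.toCochain T i j + μ.toCochain T j i = 0 := by
  simp only [toCochain]
  rw [← ofMul_mul, neg_mul_neg, μ.inv T i j h.2.1 h.2.2, ofMul_one]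

theorem Connection.triangleSum_toCochain (μ : Connection K n k) {T : Facet K n} {i j l : V}
    (hij : IsEdge T i j) (hjl : IsEdge T j l) (hli : IsEdge T l i) :
    triangleSum μ.toCochain T i j l = 0 := by
  simp only [triangleSum, toCochain]
  rw [← ofMul_mul, ← ofMul_mul, neg_mul_neg, mul_neg,
    μ.triangle T i j l hij.2.1 hjl.2.1 hli.2.1 hij.1 hjl.1 hli.1, neg_neg, ofMul_one]

theorem Connection.sum_triangles_eq_zero (μ : Connection K n k) (Δs : List (FramedTriangle K n)) :
    (Δs.map fun Δ => triangleSum μ.toCochain Δ.frame Δ.a Δ.b Δ.c).sum = 0 := by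
  refine List.sum_eq_zero fun x hx => ?_
  obtain ⟨Δ, -, rfl⟩ := List.mem_map.1 hx
  exact μ.triangleSum_toCochain Δ.ab Δ.bc Δ.ca

theorem Connection.ofMul_holonomy (μ : Connection K n k) {i j : V} (p : FramedPath K n i j) :
    Additive.ofMul (μ.holonomy p) = pathSum μ.toCochain p := by
  rw [pathSum, edgeSum_coe, holonomy, edgeProd, ofMul_list_prod, List.map_map]
  rfl

theorem Connection.holonomyRep_of (μ : Connection K n k) {x₀ : V} (p : FramedLoop K n x₀) :
    μ.holonomyRep x₀ (Abelianization.of (p : (framedCon K n x₀).Quotient)) = μ.holonomy p := rfl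

theorem Connection.holonomyRep_eq_iff (μ μ' : Connection K n k) (x₀ : V) :
    μ.holonomyRep x₀ = μ'.holonomyRep x₀ ↔
      ∀ p : FramedLoop K n x₀, pathSum μ.toCochain p = pathSum μ'.toCochain p := by
  simp only [← ofMul_holonomy, EmbeddingLike.apply_eq_iff_eq]
  refine ⟨fun h p => by rw [← holonomyRep_of, h, holonomyRep_of], fun h => ?_⟩
  refine Abelianization.hom_ext _ _ (MonoidHom.ext fun x => ?_)
  induction x using Con.induction_on with
  | H p => exact h p

theorem ofMul_along [DecidableEq V] (ρ : RhoData K n k) (i j : V) {T T' : Facet K n}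
    (w : (dualGraph K n).Walk T T') : Additive.ofMul (ρ.along i j w) =
      walkSum (fun T T' => Additive.ofMul (ρ T T' i j)) w := by
  rw [RhoData.along, ofMul_list_prod, List.map_map]
  rfl

theorem ofMul_pairProd [DecidableEq V] (ρ : RhoData K n k) (pairs : List (FramedPair K n)) :
    Additive.ofMul (pairProd ρ pairs) =
      pairSum (fun T T' i j => Additive.ofMul (ρ T T' i j)) pairs := by
  rw [pairProd, ofMul_list_prod, List.map_map, pairSum]
  refine congrArg List.sum (List.map_congr_left fun P _ => ?_)
  exact ofMul_along ρ P.i P.j P.path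

/-- Gauge equivalence in terms of the framed 1-cochains. -/
theorem gaugeEquivalent_iff (μ μ' : Connection K n k) : GaugeEquivalent μ μ' ↔
    ∃ h : V → Additive kˣ, ∀ (T : Facet K n) (i j : V), IsEdge T i j →
      μ'.toCochain T i j = h i - h j + μ.toCochain T i j := by
  constructor
  · rintro ⟨h, hh⟩
    refine ⟨fun i => Additive.ofMul (h i), fun T i j hij => ?_⟩
    rw [Connection.toCochain, Connection.toCochain, hh T i j hij.2.1 hij.2.2, ← mul_neg, ofMul_mul,
      ofMul_div]
  · rintro ⟨h, hh⟩
    refine ⟨fun i => (h i).toMul, fun T i j hi hj => ?_⟩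
    rcases eq_or_ne i j with rfl | hij
    · rw [μ.diag T i hi, μ'.diag T i hi, div_self', one_mul]
    · have := congrArg (fun x : Additive kˣ => - x.toMul) (hh T i j ⟨hij, hi, hj⟩)
      simpa [Connection.toCochain] using this

/-- A gauge transformation changes the sum along a path only at its endpoints. -/
theorem pathSum_gauge {B : Type*} [AddCommGroup B] {g g' : Facet K n → V → V → B} {h : V → B}
    (hg : ∀ (T : Facet K n) (i j : V), IsEdge T i j → g' T i j = h i - h j + g T i j) {i j : V}
    (p : FramedPath K n i j) : pathSum g' p = h i - h j + pathSum g p := by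
  induction p with
  | nil => simp [pathSum_nil]
  | cons T hT p ih =>
    rw [pathSum_cons, pathSum_cons, ih, hg T _ _ hT]
    abel

theorem pathSum_congr {B : Type*} [AddCommGroup B] {g g' : Facet K n → V → V → B}
    (hg : ∀ (T : Facet K n) (i j : V), IsEdge T i j → g T i j = g' T i j) {i j : V}
    (p : FramedPath K n i j) : pathSum g p = pathSum g' p := by
  induction p with
  | nil => simp [pathSum_nil]
  | cons T hT p ih => rw [pathSum_cons, pathSum_cons, ih, hg T _ _ hT]

theorem pathSum_add {B : Type*} [AddCommGroup B] (g g' : Facet K n → V → V → B) {i j : V}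
    (p : FramedPath K n i j) :
    pathSum (fun T i j => g T i j + g' T i j) p = pathSum g p + pathSum g' p := by
  induction p with
  | nil => simp [pathSum_nil]
  | cons T hT p ih =>
    rw [pathSum_cons, pathSum_cons, pathSum_cons, ih]
    abel

end Connection

/-! ### Holonomy determines the connection up to gauge -/

section Uniqueness

variable [DecidableEq V] {K : AbstractSimplicialComplex V} {n : ℕ} {k : Type v} [Field k]

theorem exists_framedPath (hK : IsTriangulatedManifold K n) (hconn : (edgeGraph K).Connected)
    (v w : V) : Nonempty (FramedPath K n v w) := by
  obtain ⟨p⟩ := hconn.preconnected v w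
  induction p with
  | nil => exact ⟨.nil _⟩
  | @cons a b _ h _ ih =>
    obtain ⟨T, hT⟩ := hK.exists_facet h.2
    rw [Finset.insert_subset_iff, Finset.singleton_subset_iff] at hT
    exact ih.map (.cons T ⟨h.1, hT.1, hT.2⟩)

theorem holonomyRep_eq_iff_gaugeEquivalent (hK : IsTriangulatedManifold K n)
    (hconn : (edgeGraph K).Connected) (x₀ : V) (μ μ' : Connection K n k) :
    μ.holonomyRep x₀ = μ'.holonomyRep x₀ ↔ GaugeEquivalent μ μ' := by
  rw [Connection.holonomyRep_eq_iff, gaugeEquivalent_iff]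
  constructor
  · intro h
    let p : ∀ v, FramedPath K n x₀ v := fun v => (exists_framedPath hK hconn x₀ v).some
    refine ⟨fun v => pathSum μ.toCochain (p v) - pathSum μ'.toCochain (p v), fun T i j hij => ?_⟩
    have := h ((p i).comp (.cons T hij (p j).reverse))
    simp only [pathSum_comp, pathSum_cons, pathSum_reverse μ.toCochain_anti,
      pathSum_reverse μ'.toCochain_anti] at this
    rw [← sub_eq_zero] at this ⊢
    rw [← neg_eq_zero, ← this]
    simp only [sub_eq_add_neg, neg_add, neg_neg]
    abel
  · rintro ⟨h, hh⟩ p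
    rw [pathSum_gauge hh p, sub_self, zero_add]

/-- The variation under changes of the framing and the sums along the basic closed paths determine
a connection up to gauge. -/
theorem gaugeEquivalent_of_isVariation (hK : IsTriangulatedManifold K n)
    (hconn : (edgeGraph K).Connected) {G A Z : Type*} (H : HomologyBasis K n G A Z)
    {μ μ' : Connection K n k} {r : Facet K n → Facet K n → V → V → Additive kˣ}
    (hr : IsVariation r μ.toCochain) (hr' : IsVariation r μ'.toCochain)
    (hγ : ∀ s, pathSum μ'.toCochain (H.γ s) = pathSum μ.toCochain (H.γ s))
    (ha : ∀ s, pathSum μ'.toCochain (H.a s) = pathSum μ.toCochain (H.a s)) :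
    GaugeEquivalent μ μ' := by
  obtain ⟨v₀⟩ := hconn.nonempty
  obtain ⟨T₀, -⟩ := hK.exists_facet (K.singleton_mem v₀)
  have : Nonempty (Facet K n) := ⟨T₀⟩
  have hF : ∀ i j, {i, j} ∈ K → ∃ T : Facet K n, {i, j} ⊆ T.1 := fun i j h => hK.exists_facet h
  choose! F hF using hF
  let d : Facet K n → V → V → Additive kˣ := fun T i j => μ'.toCochain T i j - μ.toCochain T i j
  let l : V → V → Additive kˣ := fun i j => d (F i j) i j
  -- The quotient of the connections does not depend on the framing.
  have hl : ∀ (T : Facet K n) i j, IsEdge T i j → d T i j = l i j := by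
    intro T i j h
    refine hK.star_eq h.pair_mem (fun T => d T i j) ?_ h.pair_subset (hF i j h.pair_mem)
    intro S S' hS h1 h2
    have e := hr S S' hS i j h.1 (Finset.subset_inter h1 h2)
    rw [hr' S S' hS i j h.1 (Finset.subset_inter h1 h2), sub_eq_sub_iff_add_eq_add] at e
    simp only [d]
    rw [sub_eq_sub_iff_add_eq_add, e, add_comm]
  have hpath : ∀ {i j : V} (p : FramedPath K n i j),
      pathSum (fun _ => l) p + pathSum μ.toCochain p = pathSum μ'.toCochain p := by
    intro i j p
    rw [← pathSum_add]
    exact pathSum_congr (fun T i j h => by rw [← hl T i j h]; exact sub_add_cancel _ _) p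
  have hbd : boundaries K.toPreAbstractSimplicialComplex 2 ≤
      (cochain fun w : Fin 2 → V => l (w 0) (w 1)).ker := by
    refine boundaries_two_le_ker l ?_ ?_
    · intro v w hne h
      obtain ⟨T, hT⟩ := hK.exists_facet h
      rw [Finset.insert_subset_iff, Finset.singleton_subset_iff] at hT
      have hvw : IsEdge T v w := ⟨hne, hT⟩
      rw [← hl T v w hvw, ← hl T w v hvw.symm, sub_add_sub_comm, μ.toCochain_anti T v w hvw,
        μ'.toCochain_anti T v w hvw, sub_zero]
    · intro x y z hxy hyz hzx h
      obtain ⟨T, hT⟩ := hK.exists_facet h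
      simp only [Finset.insert_subset_iff, Finset.singleton_subset_iff] at hT
      have e1 : IsEdge T x y := ⟨hxy, hT.1, hT.2.1⟩
      have e2 : IsEdge T y z := ⟨hyz, hT.2.1, hT.2.2⟩
      have e3 : IsEdge T z x := ⟨hzx, hT.2.2, hT.1⟩
      rw [← hl T x y e1, ← hl T y z e2, ← hl T z x e3, sub_add_sub_comm, sub_add_sub_comm]
      exact sub_eq_zero.2 ((μ'.triangleSum_toCochain e1 e2 e3).trans
        (μ.triangleSum_toCochain e1 e2 e3).symm)
  obtain ⟨h, hh⟩ := exists_potential_of_cycles (L := K.toPreAbstractSimplicialComplex) l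
    (fun v _ => exists_chain_of_connected hconn v₀ v) (by
      intro x hx
      obtain ⟨f, f', hb⟩ := H.span_one x hx
      have h0 := hbd hb
      rw [AddMonoidHom.mem_ker, map_sub, map_add, ← cochain_eq_sum, ← cochain_eq_sum,
        cochain_comp, cochain_comp] at h0
      have h1 : ∀ {x : V} (p : FramedLoop K n x),
          pathSum μ'.toCochain p = pathSum μ.toCochain p →
          cochain (fun w : Fin 2 → V => l (w 0) (w 1)) (pathChain p) = 0 := by
        intro x p hp
        rw [cochain_pathChain, ← add_eq_right (b := pathSum μ.toCochain p), hpath, hp]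
      simp only [h1 _ (hγ _), h1 _ (ha _)] at h0
      simpa [cochain_eq_sum] using h0)
  rw [gaugeEquivalent_iff]
  refine ⟨h, fun T i j hij => ?_⟩
  rw [← hh i j hij.1 hij.pair_mem, ← hl T i j hij]
  exact (sub_add_cancel _ _).symm

end Uniqueness

/-! ### The relations between the holonomies -/

section Relations

variable [DecidableEq V] {K : AbstractSimplicialComplex V} {n : ℕ} {k : Type v} [Field k]

theorem Connection.isVariation_iff (μ : Connection K n k) (ρ : RhoData K n k) :
    IsVariation (fun T T' i j => Additive.ofMul (ρ T T' i j)) μ.toCochain ↔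
      ∀ T T', (dualGraph K n).Adj T T' → ∀ i j, i ≠ j → {i, j} ⊆ T.1 ∩ T'.1 →
        μ.rho T T' i j = ρ T T' i j := by
  refine forall₃_congr fun T T' _ => forall₄_congr fun i j hij hsub => ?_
  simp only [Finset.insert_subset_iff, Finset.singleton_subset_iff, Finset.mem_inter] at hsub
  have h : IsEdge T' i j := ⟨hij, hsub.1.2, hsub.2.2⟩
  rw [sub_eq_add_neg, ← eq_neg_of_add_eq_zero_right (μ.toCochain_anti T' i j h)]
  simp only [toCochain]
  rw [← ofMul_mul, neg_mul_neg, EmbeddingLike.apply_eq_iff_eq, eq_comm, rho]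

variable {ρ : RhoData K n k} {μ : Connection K n k}

theorem closedPathRelation_of_isVariation
    (h : IsVariation (fun T T' i j => Additive.ofMul (ρ T T' i j)) μ.toCochain) :
    ClosedPathRelation ρ := by
  intro i j hij T w hw
  rw [← ofMul_eq_zero, ofMul_along, h.walkSum_eq hij w hw, sub_self]

theorem localRelations_of_isVariation
    (h : IsVariation (fun T T' i j => Additive.ofMul (ρ T T' i j)) μ.toCochain) :
    LocalRelations ρ where
  edge_inv T T' hadj i j hij hsub := by
    have h1 := h T T' hadj i j hij hsub
    have h2 := h T T' hadj j i hij.symm (by rwa [Finset.pair_comm])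
    simp only [Finset.insert_subset_iff, Finset.singleton_subset_iff, Finset.mem_inter] at hsub
    beta_reduce at h1 h2
    rw [← ofMul_eq_zero, ofMul_mul, h1, h2, sub_add_sub_comm,
      μ.toCochain_anti T i j ⟨hij, hsub.1.1, hsub.2.1⟩,
      μ.toCochain_anti T' i j ⟨hij, hsub.1.2, hsub.2.2⟩, sub_zero]
  facet_inv T T' hadj i j hij hsub := by
    have h1 := h T T' hadj i j hij hsub
    have h2 := h T' T hadj.symm i j hij (by rwa [Finset.inter_comm])
    beta_reduce at h1 h2
    rw [← ofMul_eq_zero, ofMul_mul, h1, h2]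
    abel
  relation_A T T' hadj i j l hij hjl hli hsub := by
    simp only [Finset.insert_subset_iff, Finset.singleton_subset_iff, Finset.mem_inter] at hsub
    obtain ⟨hi, hj, hl⟩ := hsub
    have h1 := h T T' hadj i j hij (by simp [Finset.insert_subset_iff, hi, hj])
    have h2 := h T T' hadj j l hjl (by simp [Finset.insert_subset_iff, hj, hl])
    have h3 := h T T' hadj l i hli (by simp [Finset.insert_subset_iff, hl, hi])
    beta_reduce at h1 h2 h3
    rw [← ofMul_eq_zero, ofMul_mul, ofMul_mul, h1, h2, h3, sub_add_sub_comm, sub_add_sub_comm]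
    exact sub_eq_zero.2 ((μ.triangleSum_toCochain ⟨hij, hi.1, hj.1⟩ ⟨hjl, hj.1, hl.1⟩
      ⟨hli, hl.1, hi.1⟩).trans (μ.triangleSum_toCochain ⟨hij, hi.2, hj.2⟩ ⟨hjl, hj.2, hl.2⟩
      ⟨hli, hl.2, hi.2⟩).symm)
  relation_B _ _ _ i j hij hsub T w _ hw :=
    closedPathRelation_of_isVariation h i j hij T w fun X hX => hsub.trans (hw X hX)

theorem pairProd_cycle_of_isVariation
    (h : IsVariation (fun T T' i j => Additive.ofMul (ρ T T' i j)) μ.toCochain)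
    (z : FramedCycle K n) : pairProd ρ z.pairs = 1 := by
  rw [← ofMul_eq_zero, ofMul_pairProd, h.pairSum_cycle μ.toCochain_anti,
    μ.sum_triangles_eq_zero, neg_zero]

theorem pairProd_torsion_of_isVariation
    (h : IsVariation (fun T T' i j => Additive.ofMul (ρ T T' i j)) μ.toCochain)
    {x : V} {a : FramedLoop K n x} {m : ℕ} (u : FramedTorsionChain a m) :
    pairProd ρ u.pairs = μ.holonomy a ^ m := by
  rw [← Additive.ofMul.apply_eq_iff_eq, ofMul_pairProd, h.pairSum_torsion μ.toCochain_anti,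
    μ.sum_triangles_eq_zero, sub_zero, ofMul_pow, μ.ofMul_holonomy]

/-! ### Reconstruction of a connection -/

theorem LocalRelations.hasPotential (hn : 2 ≤ n) (hK : IsTriangulatedManifold K n)
    (hρ : LocalRelations ρ) {i j : V} (hij : i ≠ j) (hmem : {i, j} ∈ K) :
    HasPotential (fun T T' => Additive.ofMul (ρ T T' i j)) {i, j} := by
  have hanti : ∀ T T', (dualGraph K n).Adj T T' → {i, j} ⊆ T.1 → {i, j} ⊆ T'.1 →
      Additive.ofMul (ρ T T' i j) + Additive.ofMul (ρ T' T i j) = 0 := by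
    intro T T' hadj hT hT'
    rw [← ofMul_mul, hρ.facet_inv T T' hadj i j hij (Finset.subset_inter hT hT'), ofMul_one]
  have hcard : ({i, j} : Finset V).card = 2 := Finset.card_pair hij
  rcases hn.eq_or_lt with hn2 | hn3
  · exact hK.hasPotential_of_card_eq hmem (hcard.trans hn2) _ hanti
  · refine hK.hasPotential_of_codim_two _ (σ₀ := {i, j}) ?_ hmem subset_rfl (by omega)
    intro τ hτ hc hsub
    refine hK.hasPotential_of_cycles hτ _
      (fun T T' hadj hT hT' => hanti T T' hadj (hsub.trans hT) (hsub.trans hT')) ?_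
    intro T w hw hstar
    rw [← ofMul_along, hρ.relation_B τ hτ hc i j hij hsub T w hw hstar, ofMul_one]

/-- Numbers that satisfy the local relations are the variation of a framed 1-cochain. -/
theorem LocalRelations.exists_isVariation (hn : 2 ≤ n) (hK : IsTriangulatedManifold K n)
    (hρ : LocalRelations ρ) : ∃ g : Facet K n → V → V → Additive kˣ,
      (∀ T i j, IsEdge T i j → g T i j + g T j i = 0) ∧ TriangleInvariant g ∧
      IsVariation (fun T T' i j => Additive.ofMul (ρ T T' i j)) g := by
  classical
  have hG : ∀ i j, i ≠ j ∧ {i, j} ∈ K → HasPotential (fun T T' => Additive.ofMul (ρ T T' i j))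
      {i, j} := fun i j h => hρ.hasPotential hn hK h.1 h.2
  choose! G hG using hG
  -- A well-ordering of the vertices selects one orientation of each edge.
  let R : V → V → Prop := WellOrderingRel
  have hR : ∀ i j, i ≠ j → (R i j ∧ ¬ R j i) ∨ (R j i ∧ ¬ R i j) := by
    intro i j hij
    rcases trichotomous_of R i j with h | h | h
    · exact Or.inl ⟨h, asymm_of R h⟩
    · exact absurd h hij
    · exact Or.inr ⟨h, asymm_of R h⟩
  let g : Facet K n → V → V → Additive kˣ := fun T i j => if R i j then G i j T else - G j i T
  have hgr : IsVariation (fun T T' i j => Additive.ofMul (ρ T T' i j)) g := by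
    intro T T' hadj i j hij hsub
    have hT : {i, j} ⊆ T.1 := hsub.trans Finset.inter_subset_left
    have hT' : {i, j} ⊆ T'.1 := hsub.trans Finset.inter_subset_right
    have hmem : {i, j} ∈ K := mem_of_subset T.2.1 hT (Finset.insert_nonempty _ _)
    rcases hR i j hij with ⟨h1, h2⟩ | ⟨h1, h2⟩
    · simp only [g, if_pos h1]
      exact hG i j ⟨hij, hmem⟩ T T' hadj hT hT'
    · simp only [g, if_neg h2]
      rw [Finset.pair_comm] at hT hT' hmem
      have e := hG j i ⟨hij.symm, hmem⟩ T T' hadj hT hT'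
      have e' := congrArg Additive.ofMul (hρ.edge_inv T T' hadj i j hij hsub)
      rw [ofMul_mul, ofMul_one] at e'
      beta_reduce at e
      rw [eq_neg_of_add_eq_zero_left e', e]
      abel
  refine ⟨g, fun T i j h => ?_, fun T T' i j l hij hjl hli hT hT' => ?_, hgr⟩
  · rcases hR i j h.1 with ⟨h1, h2⟩ | ⟨h1, h2⟩ <;> simp [g, h1, h2]
  · refine hK.star_eq (mem_of_subset T.2.1 hT (Finset.insert_nonempty _ _))
      (fun T => triangleSum g T i j l) ?_ hT hT'
    intro S S' hadj hS hS'
    have hsub := Finset.subset_inter hS hS'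
    have hA := congrArg Additive.ofMul (hρ.relation_A S S' hadj i j l hij hjl hli hsub)
    rw [Finset.insert_subset_iff, Finset.insert_subset_iff, Finset.singleton_subset_iff] at hsub
    have h1 := hgr S S' hadj i j hij (by simp [Finset.insert_subset_iff, hsub, -Finset.mem_inter])
    have h2 := hgr S S' hadj j l hjl (by simp [Finset.insert_subset_iff, hsub, -Finset.mem_inter])
    have h3 := hgr S S' hadj l i hli (by simp [Finset.insert_subset_iff, hsub, -Finset.mem_inter])
    beta_reduce at h1 h2 h3
    rw [ofMul_mul, ofMul_mul, ofMul_one, h1, h2, h3, sub_add_sub_comm, sub_add_sub_comm] at hA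
    exact sub_eq_zero.1 hA

open Classical in
/-- The connection `μ T i j = - g T i j` of a framed 1-cochain `g` that is closed on the framed
triangles. -/
noncomputable def Connection.ofCochain (g : Facet K n → V → V → Additive kˣ)
    (hg : ∀ T i j, IsEdge T i j → g T i j + g T j i = 0)
    (htri : ∀ T i j l, IsEdge T i j → IsEdge T j l → IsEdge T l i → triangleSum g T i j l = 0) :
    Connection K n k where
  coeff T i j := if i = j then 1 else - (g T i j).toMul
  diag T i _ := if_pos rfl
  inv T i j hi hj := by
    rcases eq_or_ne i j with rfl | h
    · simp
    · rw [if_neg h, if_neg h.symm, neg_mul_neg, ← toMul_add, hg T i j ⟨h, hi, hj⟩, toMul_zero]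
  triangle T i j l hi hj hl hij hjl hli := by
    rw [if_neg hij, if_neg hjl, if_neg hli, neg_mul_neg, mul_neg, ← toMul_add, ← toMul_add]
    have := htri T i j l ⟨hij, hi, hj⟩ ⟨hjl, hj, hl⟩ ⟨hli, hl, hi⟩
    rw [triangleSum] at this
    rw [this, toMul_zero]

theorem Connection.toCochain_ofCochain (g : Facet K n → V → V → Additive kˣ) (hg) (htri)
    (T : Facet K n) (i j : V) (h : IsEdge T i j) :
    (ofCochain (K := K) (n := n) (k := k) g hg htri).toCochain T i j = g T i j := by
  simp [toCochain, ofCochain, h.1]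

theorem exists_realizes (hn : 2 ≤ n) (hK : IsTriangulatedManifold K n)
    (hconn : (edgeGraph K).Connected) {G A Z : Type*} (H : HomologyBasis K n G A Z)
    (hρ : LocalRelations ρ) (c : G → kˣ) (α : A → kˣ) (hH : HomologicalRelations H ρ α) :
    ∃ μ : Connection K n k, Realizes H μ ρ c α := by
  obtain ⟨g, hg, hinv, hgr⟩ := hρ.exists_isVariation hn hK
  obtain ⟨e, he, htri, hγ, ha⟩ := exists_correction hK hconn H hg hinv hgr
    (fun s => Additive.ofMul (c s)) (fun s => Additive.ofMul (α s))
    (fun s => by rw [← ofMul_pairProd, hH.cycle, ofMul_one])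
    (fun s => by rw [← ofMul_pairProd, hH.torsion, ofMul_pow])
  let g' : Facet K n → V → V → Additive kˣ := fun T i j => g T i j + e i j
  have hg' : ∀ T i j, IsEdge T i j → g' T i j + g' T j i = 0 := by
    intro T i j h
    simp only [g']
    rw [add_add_add_comm, hg T i j h, he T i j h, add_zero]
  have htri' : ∀ T i j l, IsEdge T i j → IsEdge T j l → IsEdge T l i →
      triangleSum g' T i j l = 0 := by
    intro T i j l h1 h2 h3
    rw [← htri T i j l h1 h2 h3]
    simp only [triangleSum, g']
    abel
  let μ : Connection K n k := .ofCochain g' hg' htri'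
  have hμ : ∀ T i j, IsEdge T i j → μ.toCochain T i j = g' T i j :=
    Connection.toCochain_ofCochain g' hg' htri'
  have hpath : ∀ {x : V} (p : FramedLoop K n x),
      Additive.ofMul (μ.holonomy p) = pathSum g p + pathSum (fun _ => e) p := fun p => by
    rw [μ.ofMul_holonomy, ← pathSum_add]
    exact pathSum_congr hμ p
  refine ⟨μ, (μ.isVariation_iff ρ).1 ?_, fun s => ?_, fun s => ?_⟩
  · intro T T' hadj i j hij hsub
    rw [hgr T T' hadj i j hij hsub]
    simp only [Finset.insert_subset_iff, Finset.singleton_subset_iff, Finset.mem_inter] at hsub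
    rw [hμ T i j ⟨hij, hsub.1.1, hsub.2.1⟩, hμ T' i j ⟨hij, hsub.1.2, hsub.2.2⟩]
    exact (add_sub_add_right_eq_sub _ _ _).symm
  · exact Additive.ofMul.injective ((hpath _).trans (hγ s))
  · exact Additive.ofMul.injective ((hpath _).trans (ha s))

end Relations

end DiscreteConnection

open DiscreteConnection in
theorem theorem5 {k : Type*} [RCLike k] {V : Type*} [DecidableEq V]
    (K : AbstractSimplicialComplex V) (n : ℕ) (hn : 2 ≤ n)
    (hK : IsTriangulatedManifold K n) (hconn : (edgeGraph K).Connected) :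
    -- the framed abelian holonomy representation determines the connection up to gauge
    (∀ (x₀ : V) (μ μ' : Connection K n k),
      μ.holonomyRep x₀ = μ'.holonomyRep x₀ ↔ GaugeEquivalent μ μ') ∧
    -- the conditions are necessary
    (∀ μ : Connection K n k,
      LocalRelations (K := K) (n := n) μ.rho ∧
      ClosedPathRelation (K := K) (n := n) μ.rho ∧
      (∀ z : FramedCycle K n, pairProd μ.rho z.pairs = 1) ∧
      (∀ (x : V) (a : FramedLoop K n x) (r : ℕ) (u : FramedTorsionChain a r),
        pairProd μ.rho u.pairs = μ.holonomy a ^ r)) ∧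
    -- and sufficient for the reconstruction, which is unique up to gauge
    (∀ {G A Z : Type*} (H : HomologyBasis K n G A Z) (ρ : RhoData K n k)
      (c : G → kˣ) (α : A → kˣ),
      ((∃ μ : Connection K n k, Realizes H μ ρ c α) ↔
        LocalRelations ρ ∧ HomologicalRelations H ρ α) ∧
      (∀ μ μ' : Connection K n k, Realizes H μ ρ c α → Realizes H μ' ρ c α →
        GaugeEquivalent μ μ')) := by
  refine ⟨holonomyRep_eq_iff_gaugeEquivalent hK hconn, fun μ => ?_, fun H ρ c α => ⟨⟨?_, ?_⟩, ?_⟩⟩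
  · have h := (μ.isVariation_iff μ.rho).2 fun _ _ _ _ _ _ _ => rfl
    exact ⟨localRelations_of_isVariation h, closedPathRelation_of_isVariation h,
      pairProd_cycle_of_isVariation h, fun _ _ _ u => pairProd_torsion_of_isVariation h u⟩
  · rintro ⟨μ, hμ⟩
    have h := (μ.isVariation_iff ρ).2 hμ.rho_eq
    exact ⟨localRelations_of_isVariation h, fun s => pairProd_cycle_of_isVariation h _,
      fun s => by rw [pairProd_torsion_of_isVariation h, hμ.a_eq]⟩
  · exact fun h => exists_realizes hn hK hconn H h.1 c α h.2
  · intro μ μ' hμ hμ'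
    refine gaugeEquivalent_of_isVariation hK hconn H ((μ.isVariation_iff ρ).2 hμ.rho_eq)
      ((μ'.isVariation_iff ρ).2 hμ'.rho_eq) (fun s => ?_) (fun s => ?_)
    · rw [← Connection.ofMul_holonomy, ← Connection.ofMul_holonomy, hμ.γ_eq, hμ'.γ_eq]
    · rw [← Connection.ofMul_holonomy, ← Connection.ofMul_holonomy, hμ.a_eq, hμ'.a_eq]
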